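/- Let $n,k\ge 0$ and $M\ge 1$ be integers, $\mathcal M=\{1,\dots,M\}$, $\gamma>0$, and for $m\in\mathcal M$ let $A^m,D^m\in\mathbb R^{n\times n}$ and $\sigma^m\in\mathbb R^{n\times k}$. Let $|\cdot|$ be the Euclidean norm (and the corresponding operator norm). **Assumption 1.** There are $c_A,c_\sigma>0$ and $c_D$ such that, for all $m$ and $x$, $x'A^mx\le -c_A|x|^2$, $|\sigma^m|\le c_\sigma$, $D^m$ is symmetric positive definite, $x'D^mx\le c_D|x|^2$, and $c_A^2>c_Dc_\sigma^2/\gamma^2$. **Assumption 2.** There is $m_D>0$ such that $x'D^mx\ge m_D|x|^2$ for all $m$ and $x$, and $\frac{c_\sigma^2}{\gamma^2}m_D>\bigl(c_A-\sqrt{c_A^2-c_Dc_\sigma^2/\gamma^2}\bigr)^2$. **Semigroups.** For $T\ge 0$ and a function $V$ on $\mathbb R^n$ let $$S_T[V](x)=\sup_{w,\mu}\Bigl\{\int_0^T\bigl(\tfrac12\xi_t'D^{\mu_t}\xi_t-\tfrac{\gamma^2}{2}|w_t|^2\bigr)dt+V(\xi_T)\Bigr\},\qquad \dot\xi_t=A^{\mu_t}\xi_t+\sigma^{\mu_t}w_t,\quad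 \xi_0=x,$$ where the supremum (in the extended reals) is over all $w\in L^2_{loc}([0,\infty);\mathbb R^k)$ and all measurable $\mu$ with values in $\mathcal M$. Let $S^m_T$ be defined in the same way with $\mu\equiv m$ fixed, and let $\tilde S_\tau=\sup_{m\in\mathcal M}S^m_\tau$. **Riccati flow.** Let $\Sigma^m=\gamma^{-2}\sigma^m(\sigma^m)'$ and $\Phi_m(P)=(A^m)'P+PA^m+P\Sigma^mP+D^m$, and let $M^m_t[P_0]$ be the value at time $t$ of the maximal solution of $\dot P=\Phi_m(P)$, $P(0)=P_0$. Let $[\epsilon I,\lambda I]$ be the set of symmetric $P$ with $\epsilon I\le P\le\lambda I$ in the Loewner order. Put $$\lambda_1=\frac{\gamma^2\bigl(c_A-\sqrt{c_A^2-c_Dc_\sigma^2/\gamma^2}\bigr)}{c_\sigma^2},\qquad \lambda_2=\sqrt{m_D\gamma^2/c_\sigma^2}.$$ **Pruning.** A pruning operation $\mathcal P$ selects from a finite set $\{f_i\}_{i\in I}$ of functions, representing $f=\sup_{i\in I}f_i$, a subset $\{f_j\}_{j\in J}$, and one writes $\mathcal P[f]=\sup_{j\in J}f_j$. In $\{\mathcal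 P_\tau\circ\tilde S_\tau\}^N[V^0]$ the starting function $V^0$ is represented by the set $\{V^0\}$, and if $f$ is represented by $\{f_i\}_{i\in I}$, then $\tilde S_\tau[f]$ is represented by $\{S^m_\tau[f_i]: m\in\mathcal M,\ i\in I\}$. The family $(\mathcal P_\tau)_{\tau>0}$ *generates an error $O(\tau^r)$* if there is $L>0$ such that, for all $\tau>0$ and all suprema $f$ of finite nonempty sets of positive definite quadratic functions $x\mapsto\frac12x'Px$, $\ \mathcal P_\tau[f]\le f\le(1+L\tau^r)\,\mathcal P_\tau[f]$. **Theorem.** Suppose that Assumptions 1 and 2 hold. Let $\lambda\in[\lambda_1,\lambda_2)$, and let $\epsilon>0$ be such that $M^m_t[P_0]$ is defined and belongs to $[\epsilon I,\lambda I]$ for all $m\in\mathcal M$, $t\ge 0$ and $P_0\in[\epsilon I,\lambda I]$. 1. Let $r>1$ and let $(\mathcal P_\tau)_{\tau>0}$ generate an error $O(\tau^r)$. Then there are $\tau_0>0$ and $L>0$ such that $$S_{N\tau}[V^0](x)-\{\mathcal P_\tau\circ\tilde S_\tau\}^N[V^0](x)\le L\,\tau^{\min\{1,r-1\}}|x|^2$$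 for all $x\in\mathbb R^n$, all $N\in\mathbb N$, all $\tau\in(0,\tau_0]$ and all $V^0(x)=\frac12x'P_0x$ with $P_0\in[\epsilon I,\lambda I]$, both terms on the left being finite. 2. (No pruning, $r=\infty$.) There are $\tau_0>0$ and $L>0$ such that $$S_{N\tau}[V^0](x)-\{\tilde S_\tau\}^N[V^0](x)\le L\,\tau\,|x|^2$$ for the same $x$, $N$, $\tau$ and $V^0$, both terms on the left being finite. -/

import Mathlib

open MeasureTheory Set
open scoped Matrix Matrix.Norms.L2Operator MatrixOrder

/-- The data of a switching linear-quadratic control problem: `M` modes, state space `ℝⁿ`,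
disturbances in `ℝᵏ`. -/
structure SwitchedLQ (n k M : ℕ) where
  /-- drift matrices -/
  A : Fin M → Matrix (Fin n) (Fin n) ℝ
  /-- input matrices -/
  σ : Fin M → Matrix (Fin n) (Fin k) ℝ
  /-- running cost matrices -/
  D : Fin M → Matrix (Fin n) (Fin n) ℝ
  /-- attenuation parameter -/
  γ : ℝ

/-- The quadratic form `x' P x`. -/
def qform {n : ℕ} (P : Matrix (Fin n) (Fin n) ℝ) (x : EuclideanSpace ℝ (Fin n)) : ℝ :=
  x.ofLp ⬝ᵥ (P *ᵥ x.ofLp)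

/-- The quadratic function `x ↦ (1/2) x' P x`, with values in the extended reals. -/
noncomputable def quadFun {n : ℕ} (P : Matrix (Fin n) (Fin n) ℝ) :
    EuclideanSpace ℝ (Fin n) → EReal :=
  fun x => ((1 / 2 * qform P x : ℝ) : EReal)

namespace SwitchedLQ

variable {n k M : ℕ}

/-- First standing assumption, with constants `cA`, `cσ`, `cD`. The norm of `σ m` is the
operator norm for the Euclidean norms. -/
structure Assumption1 (p : SwitchedLQ n k M) (cA cσ cD : ℝ) : Prop where
  γ_pos : 0 < p.γ
  cA_pos : 0 < cA
  A_le : ∀ m x, qform (p.A m) x ≤ -cA * ‖x‖ ^ 2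
  cσ_pos : 0 < cσ
  σ_le : ∀ m, ‖p.σ m‖ ≤ cσ
  D_posDef : ∀ m, (p.D m).PosDef
  D_le : ∀ m x, qform (p.D m) x ≤ cD * ‖x‖ ^ 2
  gap : cD * cσ ^ 2 / p.γ ^ 2 < cA ^ 2

/-- Second standing assumption, with constant `mD`. -/
structure Assumption2 (p : SwitchedLQ n k M) (cA cσ cD mD : ℝ) : Prop where
  mD_pos : 0 < mD
  D_ge : ∀ m x, mD * ‖x‖ ^ 2 ≤ qform (p.D m) x
  gap : (cA - √(cA ^ 2 - cD * cσ ^ 2 / p.γ ^ 2)) ^ 2 < cσ ^ 2 / p.γ ^ 2 * mD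

/-- The threshold `λ₁`. -/
noncomputable def lam1 (p : SwitchedLQ n k M) (cA cσ cD : ℝ) : ℝ :=
  p.γ ^ 2 * (cA - √(cA ^ 2 - cD * cσ ^ 2 / p.γ ^ 2)) / cσ ^ 2

/-- The threshold `λ₂`. -/
noncomputable def lam2 (p : SwitchedLQ n k M) (cσ mD : ℝ) : ℝ :=
  √(mD * p.γ ^ 2 / cσ ^ 2)

/-- Admissible disturbances: square integrable on every bounded interval `[0, T]`. -/
def IsDisturbance (w : ℝ → EuclideanSpace ℝ (Fin k)) : Prop :=
  ∀ T : ℝ, MemLp w 2 (volume.restrict (Icc 0 T))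

/-- `ξ` solves `ξ' = A^{μ_t} ξ + σ^{μ_t} w_t`, `ξ_0 = x` on `[0, T]`, in the (Carathéodory) sense
of the integral equation. -/
def IsTrajectory (p : SwitchedLQ n k M) (T : ℝ) (x : EuclideanSpace ℝ (Fin n))
    (w : ℝ → EuclideanSpace ℝ (Fin k)) (μ : ℝ → Fin M)
    (ξ : ℝ → EuclideanSpace ℝ (Fin n)) : Prop :=
  ContinuousOn ξ (Icc 0 T) ∧
    ∀ t ∈ Icc 0 T, ξ t = x + ∫ s in (0 : ℝ)..t,
      WithLp.toLp 2 (p.A (μ s) *ᵥ (ξ s).ofLp + p.σ (μ s) *ᵥ (w s).ofLp)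

/-- The payoff `J(x, T; V; w, μ)`, where `ξ` is the trajectory from `x` driven by `(w, μ)`. -/
noncomputable def payoff (p : SwitchedLQ n k M) (T : ℝ) (V : EuclideanSpace ℝ (Fin n) → EReal)
    (w : ℝ → EuclideanSpace ℝ (Fin k)) (μ : ℝ → Fin M)
    (ξ : ℝ → EuclideanSpace ℝ (Fin n)) : EReal :=
  ((∫ t in (0 : ℝ)..T, (1 / 2 * qform (p.D (μ t)) (ξ t) - p.γ ^ 2 / 2 * ‖w t‖ ^ 2) : ℝ) : EReal)
    + V (ξ T)

/-- The semigroup `S_T`: supremum over disturbances and measurable switching controls. -/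
noncomputable def S (p : SwitchedLQ n k M) (T : ℝ) (V : EuclideanSpace ℝ (Fin n) → EReal) :
    EuclideanSpace ℝ (Fin n) → EReal :=
  fun x => sSup {v | ∃ w μ ξ, IsDisturbance w ∧ Measurable μ ∧ p.IsTrajectory T x w μ ξ ∧
    v = p.payoff T V w μ ξ}

/-- The semigroup `S^m_T` of mode `m`: the switching control is constantly `m`. -/
noncomputable def Sm (p : SwitchedLQ n k M) (m : Fin M) (T : ℝ)
    (V : EuclideanSpace ℝ (Fin n) → EReal) : EuclideanSpace ℝ (Fin n) → EReal :=
  fun x => sSup {v | ∃ w ξ, IsDisturbance w ∧ p.IsTrajectory T x w (fun _ => m) ξ ∧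
    v = p.payoff T V w (fun _ => m) ξ}

/-- The one-step operator without switching, `S̃_τ = sup_m S^m_τ`. -/
noncomputable def tildeS (p : SwitchedLQ n k M) (τ : ℝ) (V : EuclideanSpace ℝ (Fin n) → EReal) :
    EuclideanSpace ℝ (Fin n) → EReal :=
  fun x => ⨆ m, p.Sm m τ V x

/-- `Σ^m = σ^m (σ^m)' / γ²`. -/
noncomputable def Sig (p : SwitchedLQ n k M) (m : Fin M) : Matrix (Fin n) (Fin n) ℝ :=
  (1 / p.γ ^ 2) • (p.σ m * (p.σ m)ᵀ)

/-- The Riccati vector field `Φ_m(P) = A'P + PA + PΣP + D`. -/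
noncomputable def Phi (p : SwitchedLQ n k M) (m : Fin M) (P : Matrix (Fin n) (Fin n) ℝ) :
    Matrix (Fin n) (Fin n) ℝ :=
  (p.A m)ᵀ * P + P * p.A m + P * p.Sig m * P + p.D m

/-- The graph of the (partially defined) Riccati flow: `M^m_t[P₀]` is defined and equals `Q`. -/
def RiccatiFlow (p : SwitchedLQ n k M) (m : Fin M) (t : ℝ) (P₀ Q : Matrix (Fin n) (Fin n) ℝ) :
    Prop :=
  ∃ P : ℝ → Matrix (Fin n) (Fin n) ℝ, P 0 = P₀ ∧
    (∀ s ∈ Icc 0 t, HasDerivWithinAt P (p.Phi m (P s)) (Icc 0 t) s) ∧ P t = Q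

/-- The order interval `[εI, λI]` is invariant under the Riccati flow of every mode. -/
def IsInvariantInterval (p : SwitchedLQ n k M) (ε lam : ℝ) : Prop :=
  ∀ m, ∀ t : ℝ, 0 ≤ t →
    ∀ P₀ ∈ Icc (ε • (1 : Matrix (Fin n) (Fin n) ℝ)) (lam • (1 : Matrix (Fin n) (Fin n) ℝ)),
      ∃ Q ∈ Icc (ε • (1 : Matrix (Fin n) (Fin n) ℝ)) (lam • (1 : Matrix (Fin n) (Fin n) ℝ)),
        p.RiccatiFlow m t P₀ Q

open Classical in
/-- The operator `S̃_τ` on a finite set `F` of functions representing `sup F`: the set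
`{S^m_τ[f] : m, f ∈ F}`, whose supremum is `S̃_τ[sup F]` by `sup_stepSet`. -/
noncomputable def stepSet (p : SwitchedLQ n k M) (τ : ℝ)
    (F : Finset (EuclideanSpace ℝ (Fin n) → EReal)) :
    Finset (EuclideanSpace ℝ (Fin n) → EReal) :=
  (Finset.univ ×ˢ F).image fun q : Fin M × (EuclideanSpace ℝ (Fin n) → EReal) => p.Sm q.1 τ q.2

/-- The finite set of functions obtained from `{V}` after `N` steps of `S̃_τ`, each followed by
the pruning `prune`. -/
noncomputable def prunedSet (p : SwitchedLQ n k M) (τ : ℝ)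
    (prune : Finset (EuclideanSpace ℝ (Fin n) → EReal) →
      Finset (EuclideanSpace ℝ (Fin n) → EReal))
    (V : EuclideanSpace ℝ (Fin n) → EReal) :
    ℕ → Finset (EuclideanSpace ℝ (Fin n) → EReal)
  | 0 => {V}
  | N + 1 => prune (p.stepSet τ (p.prunedSet τ prune V N))

/-- The function `{𝒫_τ ∘ S̃_τ}^N[V]`. -/
noncomputable def prunedIterate (p : SwitchedLQ n k M) (τ : ℝ)
    (prune : Finset (EuclideanSpace ℝ (Fin n) → EReal) →
      Finset (EuclideanSpace ℝ (Fin n) → EReal))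
    (N : ℕ) (V : EuclideanSpace ℝ (Fin n) → EReal) : EuclideanSpace ℝ (Fin n) → EReal :=
  (p.prunedSet τ prune V N).sup id

theorem payoff_sup (p : SwitchedLQ n k M) (T : ℝ) (V W : EuclideanSpace ℝ (Fin n) → EReal)
    (w : ℝ → EuclideanSpace ℝ (Fin k)) (μ : ℝ → Fin M) (ξ : ℝ → EuclideanSpace ℝ (Fin n)) :
    p.payoff T (V ⊔ W) w μ ξ = p.payoff T V w μ ξ ⊔ p.payoff T W w μ ξ := by
  have h : Monotone fun y : EReal => ((∫ t in (0 : ℝ)..T,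
      (1 / 2 * qform (p.D (μ t)) (ξ t) - p.γ ^ 2 / 2 * ‖w t‖ ^ 2) : ℝ) : EReal) + y :=
    fun a b hab => add_le_add le_rfl hab
  exact h.map_sup _ _

theorem Sm_sup (p : SwitchedLQ n k M) (m : Fin M) (T : ℝ)
    (V W : EuclideanSpace ℝ (Fin n) → EReal) :
    p.Sm m T (V ⊔ W) = p.Sm m T V ⊔ p.Sm m T W := by
  funext x
  apply le_antisymm
  · refine sSup_le ?_
    rintro v ⟨w, ξ, hw, hξ, rfl⟩
    rw [payoff_sup]
    exact sup_le_sup (le_sSup ⟨w, ξ, hw, hξ, rfl⟩) (le_sSup ⟨w, ξ, hw, hξ, rfl⟩)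
  · refine sup_le (sSup_le ?_) (sSup_le ?_)
    · rintro v ⟨w, ξ, hw, hξ, rfl⟩
      refine le_sSup_of_le ⟨w, ξ, hw, hξ, rfl⟩ ?_
      rw [payoff_sup]; exact le_sup_left
    · rintro v ⟨w, ξ, hw, hξ, rfl⟩
      refine le_sSup_of_le ⟨w, ξ, hw, hξ, rfl⟩ ?_
      rw [payoff_sup]; exact le_sup_right

theorem Sm_bot (p : SwitchedLQ n k M) (m : Fin M) (T : ℝ) : p.Sm m T ⊥ = ⊥ := by
  funext x
  refine le_bot_iff.1 (sSup_le ?_)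
  rintro v ⟨w, ξ, hw, hξ, rfl⟩
  simp [payoff]

/-- Max-plus linearity: `stepSet` represents `S̃_τ` applied to the represented function. -/
theorem sup_stepSet (p : SwitchedLQ n k M) (τ : ℝ)
    (F : Finset (EuclideanSpace ℝ (Fin n) → EReal)) :
    (p.stepSet τ F).sup id = p.tildeS τ (F.sup id) := by
  classical
  have h : ∀ m, p.Sm m τ (F.sup id) = F.sup fun f => p.Sm m τ f := fun m =>
    Finset.apply_sup_eq_sup_comp (p.Sm m τ) (fun V W => p.Sm_sup m τ V W) (p.Sm_bot m τ)
  funext x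
  unfold stepSet tildeS
  simp only [h, Finset.sup_image, Finset.sup_product_left, Finset.sup_apply, Function.comp, id,
    Finset.sup_univ_eq_iSup]

end SwitchedLQ

/-- The family `prune τ`, `τ > 0`, of pruning operations generates an error `O(τ^r)`: it selects from
every nonempty finite set `F` of positive definite quadratic functions a subset `prune τ F` such that,
with a constant `L` independent of `τ` and `F`, and with `f = sup F`, `𝒫_τ[f] = sup (prune τ F)`,
one has `𝒫_τ[f] ≤ f ≤ (1 + L τ^r) 𝒫_τ[f]`. -/
def IsPruningOfOrder {n : ℕ}
    (prune : ℝ → Finset (EuclideanSpace ℝ (Fin n) → EReal) →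
      Finset (EuclideanSpace ℝ (Fin n) → EReal)) (r : ℝ) : Prop :=
  ∃ L : ℝ, 0 < L ∧ ∀ τ : ℝ, 0 < τ →
    ∀ F : Finset (EuclideanSpace ℝ (Fin n) → EReal), F.Nonempty →
      (∀ f ∈ F, ∃ P : Matrix (Fin n) (Fin n) ℝ, P.PosDef ∧ f = quadFun P) →
      prune τ F ⊆ F ∧ ∀ x, (prune τ F).sup id x ≤ F.sup id x ∧
        F.sup id x ≤ ((1 + L * τ ^ r : ℝ) : EReal) * (prune τ F).sup id x

/-!
For symmetric `P`, completing the square turns the payoff with final value `½ x' P x` into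
`½ x' P x + ½ ∫ (ξ' Φ_μ(P) ξ - γ² |w - γ⁻² σ' P ξ|²)`. Over a time `τ` the state hardly moves unless
the square is large, so switching within the step improves on the best fixed mode by at most
`O(τ²) |x|²`. This one-step error is paid for by contraction: below `λ₂` the fields `Φ_m` are
strictly subhomogeneous, `Φ_m((1 + θ) P) ≤ (1 + θ) Φ_m(P) - θ η I`, so that
`S_τ[(1 + θ) V] ≤ (1 + θ (1 - α τ) + C τ²) S̃_τ[V]` for all suprema `V` of quadratic forms in
`[εI, λI]`. Hence the relative error `θ = K τ ^ min 1 (r - 1)` survives a time step followed by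
pruning with factor `1 + L τ ^ r`, and it bounds the error after any number of steps.
-/

open Filter Topology
open scoped RealInnerProductSpace

section MatrixVector

variable {m n k : ℕ}

/-- Matrix-vector multiplication on Euclidean spaces as a continuous bilinear map, so that norm
estimates and derivatives of `t ↦ Q t *ᵥ ξ t` come from the general theory. -/
noncomputable def mulVecL : Matrix (Fin m) (Fin n) ℝ →L[ℝ]
    EuclideanSpace ℝ (Fin n) →L[ℝ] EuclideanSpace ℝ (Fin m) :=
  LinearMap.mkContinuous₂ (Matrix.toEuclideanLin (𝕜 := ℝ)).toLinearMap 1 fun A x => by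
    rw [one_mul]
    exact Matrix.l2_opNorm_mulVec A x

theorem mulVecL_apply (A : Matrix (Fin m) (Fin n) ℝ) (x : EuclideanSpace ℝ (Fin n)) :
    mulVecL A x = WithLp.toLp 2 (A *ᵥ x.ofLp) := rfl

theorem norm_mulVecL_le (A : Matrix (Fin m) (Fin n) ℝ) (x : EuclideanSpace ℝ (Fin n)) :
    ‖mulVecL A x‖ ≤ ‖A‖ * ‖x‖ := Matrix.l2_opNorm_mulVec A x

theorem mulVecL_mul (A : Matrix (Fin m) (Fin n) ℝ) (B : Matrix (Fin n) (Fin k) ℝ)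
    (x : EuclideanSpace ℝ (Fin k)) : mulVecL (A * B) x = mulVecL A (mulVecL B x) := by
  simp [mulVecL_apply, Matrix.mulVec_mulVec]

theorem mulVecL_one (x : EuclideanSpace ℝ (Fin n)) :
    mulVecL (1 : Matrix (Fin n) (Fin n) ℝ) x = x := by
  simp [mulVecL_apply]

theorem inner_mulVecL_left (A : Matrix (Fin m) (Fin n) ℝ) (x : EuclideanSpace ℝ (Fin n))
    (y : EuclideanSpace ℝ (Fin m)) : ⟪mulVecL A x, y⟫ = ⟪x, mulVecL Aᵀ y⟫ := by
  simp only [mulVecL_apply, EuclideanSpace.inner_eq_star_dotProduct, star_trivial]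
  rw [Matrix.dotProduct_mulVec, Matrix.mulVec_transpose, dotProduct_comm]

theorem inner_mulVecL_comm {P : Matrix (Fin n) (Fin n) ℝ} (hP : Pᵀ = P)
    (x y : EuclideanSpace ℝ (Fin n)) : ⟪mulVecL P x, y⟫ = ⟪x, mulVecL P y⟫ := by
  rw [inner_mulVecL_left, hP]

theorem norm_transpose_eq (A : Matrix (Fin m) (Fin n) ℝ) : ‖Aᵀ‖ = ‖A‖ := by
  rw [← Matrix.conjTranspose_eq_transpose_of_trivial, Matrix.l2_opNorm_conjTranspose]

theorem qform_eq_inner (P : Matrix (Fin n) (Fin n) ℝ) (x : EuclideanSpace ℝ (Fin n)) :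
    qform P x = ⟪x, mulVecL P x⟫ :=
  dotProduct_comm _ _

theorem qform_add (P Q : Matrix (Fin n) (Fin n) ℝ) (x : EuclideanSpace ℝ (Fin n)) :
    qform (P + Q) x = qform P x + qform Q x := by
  simp [qform_eq_inner, inner_add_right]

theorem qform_sub (P Q : Matrix (Fin n) (Fin n) ℝ) (x : EuclideanSpace ℝ (Fin n)) :
    qform (P - Q) x = qform P x - qform Q x := by
  simp [qform_eq_inner, inner_sub_right]

theorem qform_smul (c : ℝ) (P : Matrix (Fin n) (Fin n) ℝ) (x : EuclideanSpace ℝ (Fin n)) :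
    qform (c • P) x = c * qform P x := by
  simp [qform_eq_inner, inner_smul_right]

theorem qform_one (x : EuclideanSpace ℝ (Fin n)) :
    qform (1 : Matrix (Fin n) (Fin n) ℝ) x = ‖x‖ ^ 2 := by
  rw [qform_eq_inner, mulVecL_one, real_inner_self_eq_norm_sq]

theorem abs_qform_le (P : Matrix (Fin n) (Fin n) ℝ) (x : EuclideanSpace ℝ (Fin n)) :
    |qform P x| ≤ ‖P‖ * ‖x‖ ^ 2 := by
  rw [qform_eq_inner]
  calc |⟪x, mulVecL P x⟫| ≤ ‖x‖ * ‖mulVecL P x‖ := abs_real_inner_le_norm _ _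
    _ ≤ ‖x‖ * (‖P‖ * ‖x‖) := by gcongr; exact norm_mulVecL_le _ _
    _ = ‖P‖ * ‖x‖ ^ 2 := by ring

theorem qform_le_add_norm (P : Matrix (Fin n) (Fin n) ℝ) (x y : EuclideanSpace ℝ (Fin n)) :
    qform P y ≤ qform P x + ‖P‖ * (2 * ‖x‖ * ‖y - x‖ + ‖y - x‖ ^ 2) := by
  have expand : qform P y = qform P x + ⟪x, mulVecL P (y - x)⟫ + ⟪y - x, mulVecL P x⟫ +
      qform P (y - x) := by
    simp only [qform_eq_inner, map_sub, inner_sub_left, inner_sub_right]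
    ring
  have hx : ⟪x, mulVecL P (y - x)⟫ ≤ ‖x‖ * (‖P‖ * ‖y - x‖) :=
    (real_inner_le_norm _ _).trans (by gcongr; exact norm_mulVecL_le _ _)
  have hy : ⟪y - x, mulVecL P x⟫ ≤ ‖y - x‖ * (‖P‖ * ‖x‖) :=
    (real_inner_le_norm _ _).trans (by gcongr; exact norm_mulVecL_le _ _)
  have hyy := (le_abs_self _).trans (abs_qform_le P (y - x))
  linarith

theorem le_iff_qform_le {P Q : Matrix (Fin n) (Fin n) ℝ} :
    P ≤ Q ↔ (Q - P)ᵀ = Q - P ∧ ∀ x, qform P x ≤ qform Q x := by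
  rw [Matrix.le_iff, Matrix.posSemidef_iff_dotProduct_mulVec, Matrix.IsHermitian,
    Matrix.conjTranspose_eq_transpose_of_trivial]
  refine and_congr_right' ⟨fun h x => ?_, fun h x => ?_⟩
  · have : 0 ≤ qform (Q - P) x := h x.ofLp
    linarith [qform_sub Q P x]
  · have : 0 ≤ qform (Q - P) (WithLp.toLp 2 x) := by
      linarith [qform_sub Q P (.toLp 2 x), h (.toLp 2 x)]
    exact this

/-- The order interval `[εI, λI]`. -/
abbrev loewnerIcc (n : ℕ) (ε lam : ℝ) : Set (Matrix (Fin n) (Fin n) ℝ) :=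
  Icc (ε • 1) (lam • 1)

variable {P : Matrix (Fin n) (Fin n) ℝ} {ε lam : ℝ}

theorem mem_loewnerIcc_iff : P ∈ loewnerIcc n ε lam ↔
    Pᵀ = P ∧ ∀ x, ε * ‖x‖ ^ 2 ≤ qform P x ∧ qform P x ≤ lam * ‖x‖ ^ 2 := by
  rw [mem_Icc, le_iff_qform_le, le_iff_qform_le]
  simp only [qform_smul, qform_one, Matrix.transpose_sub, Matrix.transpose_smul,
    Matrix.transpose_one, sub_left_inj, sub_right_inj, forall_and]
  tauto

theorem norm_le_of_abs_qform_le (hP : Pᵀ = P) {c : ℝ} (hc : 0 ≤ c)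
    (h : ∀ x, |qform P x| ≤ c * ‖x‖ ^ 2) : ‖P‖ ≤ c := by
  have symm : (Matrix.toEuclideanCLM (𝕜 := ℝ) P).IsSymmetric := inner_mulVecL_comm hP
  rw [← Matrix.l2_opNorm_toEuclideanCLM,
    ContinuousLinearMap.norm_eq_iSup_rayleighQuotient _ symm]
  refine ciSup_le fun x => ?_
  have hx : |inner ℝ (Matrix.toEuclideanCLM (𝕜 := ℝ) P x) x| ≤ c * ‖x‖ ^ 2 := by
    rw [real_inner_comm]
    exact qform_eq_inner P x ▸ h x
  rw [ContinuousLinearMap.rayleighQuotient, ContinuousLinearMap.reApplyInnerSelf_apply, abs_div,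
    abs_sq]
  exact div_le_of_le_mul₀ (by positivity) hc hx

theorem norm_le_of_mem_loewnerIcc {Λ : ℝ} (hε : 0 ≤ ε) (hΛ : 0 ≤ Λ) (hlam : lam ≤ Λ)
    (h : P ∈ loewnerIcc n ε lam) : ‖P‖ ≤ Λ := by
  obtain ⟨hP, hbound⟩ := mem_loewnerIcc_iff.1 h
  refine norm_le_of_abs_qform_le hP hΛ fun x => ?_
  rw [abs_of_nonneg ((by positivity : 0 ≤ ε * ‖x‖ ^ 2).trans (hbound x).1)]
  exact (hbound x).2.trans (by gcongr)

theorem posDef_of_mem_loewnerIcc (hε : 0 < ε) (h : P ∈ loewnerIcc n ε lam) : P.PosDef := by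
  obtain ⟨hP, hbound⟩ := mem_loewnerIcc_iff.1 h
  rw [Matrix.posDef_iff_dotProduct_mulVec]
  refine ⟨by rwa [Matrix.IsHermitian, Matrix.conjTranspose_eq_transpose_of_trivial], ?_⟩
  intro x hx
  have hx' : 0 < ‖WithLp.toLp 2 x‖ := norm_pos_iff.2 (by simpa using hx)
  exact (by positivity : 0 < ε * ‖WithLp.toLp 2 x‖ ^ 2).trans_le (hbound (WithLp.toLp 2 x)).1

end MatrixVector

section ProductRule

variable {a b T : ℝ}

open AbsolutelyContinuousOnInterval in
theorem absolutelyContinuousOnInterval_of_dist_le {X Y : Type*} [PseudoMetricSpace X]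
    [PseudoMetricSpace Y] {f : ℝ → X} {g : ℝ → Y} (hg : AbsolutelyContinuousOnInterval g a b)
    (h : ∀ s ∈ uIcc a b, ∀ t ∈ uIcc a b, dist (f s) (f t) ≤ dist (g s) (g t)) :
    AbsolutelyContinuousOnInterval f a b := by
  refine squeeze_zero' (.of_forall fun E => Finset.sum_nonneg fun i _ => dist_nonneg) ?_ hg
  filter_upwards [mem_inf_of_right (mem_principal_self (disjWithin a b))] with E hE
  exact Finset.sum_le_sum fun i hi => h _ (hE.1 i hi).1 _ (hE.1 i hi).2

section Bilinear

variable {E F G : Type*} [NormedAddCommGroup E] [NormedSpace ℝ E] [NormedAddCommGroup F]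
  [NormedSpace ℝ F] [NormedAddCommGroup G] [NormedSpace ℝ G]

theorem absolutelyContinuousOnInterval_const_add_integral {g : ℝ → E}
    (hg : IntervalIntegrable g volume a b) (x : E) :
    AbsolutelyContinuousOnInterval (fun t => x + ∫ s in a..t, g s) a b := by
  refine absolutelyContinuousOnInterval_of_dist_le
    (hg.norm.absolutelyContinuousOnInterval_intervalIntegral left_mem_uIcc) fun s hs t ht => ?_
  have hga : ∀ r ∈ uIcc a b, IntervalIntegrable g volume a r := fun r hr =>
    hg.mono_set (uIcc_subset_uIcc_left hr)
  rw [dist_add_left, dist_eq_norm, dist_eq_norm,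
    intervalIntegral.integral_interval_sub_left (hga s hs) (hga t ht),
    intervalIntegral.integral_interval_sub_left (hga s hs).norm (hga t ht).norm]
  exact intervalIntegral.norm_integral_le_abs_integral_norm

open AbsolutelyContinuousOnInterval in
theorem absolutelyContinuousOnInterval_bilinear {f : E × F → G} (hf : IsBoundedBilinearMap ℝ f)
    {u : ℝ → E} {v : ℝ → F} (hu : AbsolutelyContinuousOnInterval u a b)
    (hv : AbsolutelyContinuousOnInterval v a b) :
    AbsolutelyContinuousOnInterval (fun t => f (u t, v t)) a b := by
  obtain ⟨C, hC0, hC⟩ := hf.bound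
  obtain ⟨R, hR⟩ := hu.exists_bound
  obtain ⟨R', hR'⟩ := hv.exists_bound
  have lim := (Tendsto.const_mul (C * R') hu).add (Tendsto.const_mul (C * R) hv)
  rw [mul_zero, mul_zero, add_zero] at lim
  refine squeeze_zero' (.of_forall fun I => Finset.sum_nonneg fun i _ => dist_nonneg) ?_ lim
  filter_upwards [mem_inf_of_right (mem_principal_self (disjWithin a b))] with I hI
  rw [Finset.mul_sum, Finset.mul_sum, ← Finset.sum_add_distrib]
  refine Finset.sum_le_sum fun i hi => ?_
  obtain ⟨hs, ht⟩ := hI.1 i hi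
  generalize (I.2 i).1 = s at hs ⊢
  generalize (I.2 i).2 = t at ht ⊢
  have split : f (u s, v s) - f (u t, v t) = f (u s - u t, v s) + f (u t, v s - v t) := by
    rw [hf.map_sub_left, hf.map_sub_right]
    abel
  rw [dist_eq_norm, dist_eq_norm, dist_eq_norm, split]
  calc ‖f (u s - u t, v s) + f (u t, v s - v t)‖
      ≤ C * ‖u s - u t‖ * ‖v s‖ + C * ‖u t‖ * ‖v s - v t‖ :=
        norm_add_le_of_le (hC _ _) (hC _ _)
    _ ≤ C * ‖u s - u t‖ * R' + C * R * ‖v s - v t‖ := by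
        gcongr
        exacts [hR' s hs, hR t ht]
    _ = C * R' * ‖u s - u t‖ + C * R * ‖v s - v t‖ := by ring

end Bilinear

variable {n : ℕ} {Q Q' : ℝ → Matrix (Fin n) (Fin n) ℝ} {ξ g : ℝ → EuclideanSpace ℝ (Fin n)}
  {x : EuclideanSpace ℝ (Fin n)}

theorem absolutelyContinuousOnInterval_qform (hQ : AbsolutelyContinuousOnInterval Q a b)
    (hξ : AbsolutelyContinuousOnInterval ξ a b) :
    AbsolutelyContinuousOnInterval (fun t => qform (Q t) (ξ t)) a b := by
  simp only [qform_eq_inner]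
  have mul_ac := absolutelyContinuousOnInterval_bilinear
    (mulVecL (m := n) (n := n)).isBoundedBilinearMap hQ hξ
  have inner_ac := absolutelyContinuousOnInterval_bilinear
    (isBoundedBilinearMap_inner (𝕜 := ℝ) (E := EuclideanSpace ℝ (Fin n))) hξ mul_ac
  exact inner_ac

theorem hasDerivAt_qform {t : ℝ} {P' : Matrix (Fin n) (Fin n) ℝ} {v : EuclideanSpace ℝ (Fin n)}
    (hQ : HasDerivAt Q P' t) (hξ : HasDerivAt ξ v t) (hsymm : (Q t)ᵀ = Q t) :
    HasDerivAt (fun t => qform (Q t) (ξ t))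
      (2 * ⟪mulVecL (Q t) (ξ t), v⟫ + qform P' (ξ t)) t := by
  have hmul : HasDerivAt (fun t => mulVecL (Q t) (ξ t))
      (mulVecL P' (ξ t) + mulVecL (Q t) v) t :=
    (mulVecL.hasFDerivAt.comp_hasDerivAt t hQ).clm_apply hξ
  simp only [qform_eq_inner]
  convert! hξ.inner ℝ hmul using 1
  rw [inner_add_right, inner_mulVecL_comm hsymm, real_inner_comm (mulVecL (Q t) (ξ t)) v,
    inner_mulVecL_comm hsymm]
  ring

/-- Along a Carathéodory trajectory `ξ` the function `t ↦ ξ_t' Q_t ξ_t` is only absolutely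
continuous, so the product rule is available a.e. and is integrated by Lebesgue's theorem. -/
theorem qform_eq_add_integral (hT : 0 ≤ T) (hg : IntervalIntegrable g volume 0 T)
    (hξ : ∀ t ∈ Icc 0 T, ξ t = x + ∫ s in (0 : ℝ)..t, g s)
    (hQ : ∀ t ∈ Icc 0 T, HasDerivWithinAt Q (Q' t) (Icc 0 T) t) (hQ' : ContinuousOn Q' (Icc 0 T))
    (hsymm : ∀ t ∈ Icc 0 T, (Q t)ᵀ = Q t) :
    qform (Q T) (ξ T) = qform (Q 0) x +
      ∫ t in (0 : ℝ)..T, (2 * ⟪mulVecL (Q t) (ξ t), g t⟫ + qform (Q' t) (ξ t)) := by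
  have hξ_ac : AbsolutelyContinuousOnInterval ξ 0 T :=
    absolutelyContinuousOnInterval_of_dist_le
      (absolutelyContinuousOnInterval_const_add_integral hg x) fun s hs t ht => by
        rw [uIcc_of_le hT] at hs ht
        rw [hξ s hs, hξ t ht]
  have hQ_ac : AbsolutelyContinuousOnInterval Q 0 T := by
    obtain ⟨C, hC⟩ := isCompact_Icc.exists_bound_of_continuousOn hQ'
    have lip := (convex_Icc (0 : ℝ) T).lipschitzOnWith_of_nnnorm_hasDerivWithin_le
      (C := C.toNNReal) hQ fun t ht => by
        rw [← norm_toNNReal]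
        exact Real.toNNReal_le_toNNReal (hC t ht)
    rw [← uIcc_of_le hT] at lip
    exact lip.absolutelyContinuousOnInterval
  have ftc := (absolutelyContinuousOnInterval_qform hQ_ac hξ_ac).integral_deriv_eq_sub
  have hξ0 : ξ 0 = x := by simpa using hξ 0 (left_mem_Icc.2 hT)
  rw [← sub_eq_iff_eq_add', ← hξ0, ← ftc]
  refine intervalIntegral.integral_congr_ae ?_
  filter_upwards [hg.ae_hasDerivAt_integral, Measure.ae_ne volume T] with t hderiv hne ht
  rw [uIoc_of_le hT] at ht
  have htT : t ∈ Icc 0 T := Ioc_subset_Icc_self ht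
  have nhds_t : Icc 0 T ∈ 𝓝 t := Icc_mem_nhds ht.1 (lt_of_le_of_ne ht.2 hne)
  have hξ' : HasDerivAt ξ (g t) t :=
    ((hderiv (by rwa [uIcc_of_le hT]) 0 left_mem_uIcc).const_add x).congr_of_eventuallyEq
      (eventually_of_mem nhds_t hξ)
  exact (hasDerivAt_qform ((hQ t htT).hasDerivAt nhds_t) hξ' (hsymm t htT)).deriv

end ProductRule

section SquareIntegrable

variable {a b T : ℝ}

theorem memLp_Icc_of_continuousOn {E : Type*} [NormedAddCommGroup E] {u : ℝ → E}
    (hu : ContinuousOn u (Icc a b)) (p : ENNReal) : MemLp u p (volume.restrict (Icc a b)) := by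
  obtain ⟨R, hR⟩ := isCompact_Icc.exists_bound_of_continuousOn hu
  exact .of_bound (hu.aestronglyMeasurable_of_isCompact isCompact_Icc measurableSet_Icc) R
    (ae_restrict_of_forall_mem measurableSet_Icc hR)

theorem intervalIntegrable_of_memLp_two {E : Type*} [NormedAddCommGroup E] {u : ℝ → E}
    (hab : a ≤ b) (hu : MemLp u 2 (volume.restrict (Icc a b))) :
    IntervalIntegrable u volume a b :=
  (intervalIntegrable_iff_integrableOn_Icc_of_le hab).2 (hu.integrable one_le_two)

theorem integrable_inner_of_memLp_two {E α : Type*} [NormedAddCommGroup E]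
    [InnerProductSpace ℝ E] [MeasurableSpace α] {ν : Measure α} {u v : α → E}
    (hu : MemLp u 2 ν) (hv : MemLp v 2 ν) : Integrable (fun t => ⟪u t, v t⟫) ν :=
  memLp_one_iff_integrable.1 <| MemLp.of_bilin (fun x y => ⟪x, y⟫) 1 hu hv (hu.1.inner hv.1) <|
    .of_forall fun t => by simpa using nnnorm_inner_le_nnnorm (𝕜 := ℝ) (u t) (v t)

theorem memLp_mulVecL_comp {m n M : ℕ} (B : Fin M → Matrix (Fin m) (Fin n) ℝ) {μ : ℝ → Fin M}
    (hμ : Measurable μ) {q : ENNReal} {ν : Measure ℝ} {u : ℝ → EuclideanSpace ℝ (Fin n)}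
    (hu : MemLp u q ν) : MemLp (fun t => mulVecL (B (μ t)) (u t)) q ν := by
  obtain ⟨K, hK⟩ := Finite.exists_le fun m => ‖B m‖
  have hB : StronglyMeasurable (B ∘ μ) := StronglyMeasurable.of_discrete.comp_measurable hμ
  exact mulVecL.memLp_of_bilin q
    (memLp_top_of_bound hB.aestronglyMeasurable K (.of_forall fun t => hK (μ t))) hu

theorem sq_intervalIntegral_le (hab : a < b) {f : ℝ → ℝ} (hf : IntervalIntegrable f volume a b)
    (hf2 : IntervalIntegrable (fun t => f t ^ 2) volume a b) :
    (∫ t in a..b, f t) ^ 2 ≤ (b - a) * ∫ t in a..b, f t ^ 2 := by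
  set Y := ∫ t in a..b, f t with hY
  have variance_nonneg : 0 ≤ ∫ t in a..b, ((b - a) * f t - Y) ^ 2 :=
    intervalIntegral.integral_nonneg hab.le fun t _ => sq_nonneg _
  have variance_eq : ∫ t in a..b, ((b - a) * f t - Y) ^ 2 =
      (b - a) * ((b - a) * (∫ t in a..b, f t ^ 2) - Y ^ 2) := by
    have expand : ∀ t, ((b - a) * f t - Y) ^ 2 =
        (b - a) ^ 2 * f t ^ 2 - 2 * (b - a) * Y * f t + Y ^ 2 := fun t => by ring
    simp only [expand]
    rw [intervalIntegral.integral_add ((hf2.const_mul _).sub (hf.const_mul _))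
        intervalIntegrable_const, intervalIntegral.integral_sub (hf2.const_mul _) (hf.const_mul _),
      intervalIntegral.integral_const_mul, intervalIntegral.integral_const_mul, ← hY,
      intervalIntegral.integral_const, smul_eq_mul]
    ring
  rw [variance_eq] at variance_nonneg
  exact sub_nonneg.1 (nonneg_of_mul_nonneg_right variance_nonneg (sub_pos.2 hab))

end SquareIntegrable

namespace SwitchedLQ

variable {n k M : ℕ} (p : SwitchedLQ n k M)

section Verification

/-- The right-hand side `A^m x + σ^m w` of the dynamics. -/
noncomputable def velocity (m : Fin M) (x : EuclideanSpace ℝ (Fin n))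
    (w : EuclideanSpace ℝ (Fin k)) : EuclideanSpace ℝ (Fin n) :=
  mulVecL (p.A m) x + mulVecL (p.σ m) w

/-- The running part of the payoff. -/
noncomputable def cost (T : ℝ) (w : ℝ → EuclideanSpace ℝ (Fin k)) (μ : ℝ → Fin M)
    (ξ : ℝ → EuclideanSpace ℝ (Fin n)) : ℝ :=
  ∫ t in (0 : ℝ)..T, (1 / 2 * qform (p.D (μ t)) (ξ t) - p.γ ^ 2 / 2 * ‖w t‖ ^ 2)

/-- The deviation of the disturbance `w` from the feedback `γ⁻² σ' P x`, which maximizes the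
Hamiltonian at the state `x` and costate `P x`. -/
noncomputable def deviation (m : Fin M) (P : Matrix (Fin n) (Fin n) ℝ)
    (x : EuclideanSpace ℝ (Fin n)) (w : EuclideanSpace ℝ (Fin k)) : EuclideanSpace ℝ (Fin k) :=
  w - (1 / p.γ ^ 2) • mulVecL (p.σ m)ᵀ (mulVecL P x)

variable {p} {T : ℝ} {x : EuclideanSpace ℝ (Fin n)} {w : ℝ → EuclideanSpace ℝ (Fin k)}
  {μ : ℝ → Fin M} {ξ : ℝ → EuclideanSpace ℝ (Fin n)}

theorem payoff_eq_cost_add (V : EuclideanSpace ℝ (Fin n) → EReal) :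
    p.payoff T V w μ ξ = (p.cost T w μ ξ : EReal) + V (ξ T) := rfl

theorem payoff_quadFun (P : Matrix (Fin n) (Fin n) ℝ) : p.payoff T (quadFun P) w μ ξ =
    ((p.cost T w μ ξ + 1 / 2 * qform P (ξ T) : ℝ) : EReal) := rfl

theorem IsTrajectory.eq_add_integral (h : p.IsTrajectory T x w μ ξ) :
    ∀ t ∈ Icc 0 T, ξ t = x + ∫ s in (0 : ℝ)..t, p.velocity (μ s) (ξ s) (w s) := h.2

theorem integrableOn_cost (hw : IsDisturbance w) (hμ : Measurable μ)
    (hξ : ContinuousOn ξ (Icc 0 T)) :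
    IntegrableOn (fun t => 1 / 2 * qform (p.D (μ t)) (ξ t) - p.γ ^ 2 / 2 * ‖w t‖ ^ 2)
      (Icc 0 T) := by
  have hξ2 := memLp_Icc_of_continuousOn hξ 2
  simp only [qform_eq_inner]
  exact ((integrable_inner_of_memLp_two hξ2 (memLp_mulVecL_comp p.D hμ hξ2)).const_mul _).sub
    (((hw T).integrable_norm_pow two_ne_zero).const_mul _)

theorem memLp_velocity (hw : IsDisturbance w) (hμ : Measurable μ)
    (hξ : ContinuousOn ξ (Icc 0 T)) :
    MemLp (fun t => p.velocity (μ t) (ξ t) (w t)) 2 (volume.restrict (Icc 0 T)) :=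
  (memLp_mulVecL_comp p.A hμ (memLp_Icc_of_continuousOn hξ 2)).add
    (memLp_mulVecL_comp p.σ hμ (hw T))

theorem memLp_deviation (hw : IsDisturbance w) (hμ : Measurable μ)
    (hξ : ContinuousOn ξ (Icc 0 T)) (P : Matrix (Fin n) (Fin n) ℝ) :
    MemLp (fun t => p.deviation (μ t) P (ξ t) (w t)) 2 (volume.restrict (Icc 0 T)) := by
  have hPξ : ContinuousOn (fun t => mulVecL P (ξ t)) (Icc 0 T) :=
    (mulVecL P).continuous.comp_continuousOn hξ
  exact (hw T).sub ((memLp_mulVecL_comp (fun m => (p.σ m)ᵀ) hμ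
    (memLp_Icc_of_continuousOn hPξ 2)).const_smul (1 / p.γ ^ 2))

theorem qform_Phi (m : Fin M) {P : Matrix (Fin n) (Fin n) ℝ} (hP : Pᵀ = P)
    (x : EuclideanSpace ℝ (Fin n)) :
    qform (p.Phi m P) x = 2 * ⟪mulVecL P x, mulVecL (p.A m) x⟫ +
      1 / p.γ ^ 2 * ‖mulVecL (p.σ m)ᵀ (mulVecL P x)‖ ^ 2 + qform (p.D m) x := by
  have left : qform ((p.A m)ᵀ * P) x = ⟪mulVecL P x, mulVecL (p.A m) x⟫ := by
    rw [qform_eq_inner, mulVecL_mul, ← inner_mulVecL_left, real_inner_comm]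
  have right : qform (P * p.A m) x = ⟪mulVecL P x, mulVecL (p.A m) x⟫ := by
    rw [qform_eq_inner, mulVecL_mul, inner_mulVecL_comm hP]
  have quadratic : qform (P * p.Sig m * P) x =
      1 / p.γ ^ 2 * ‖mulVecL (p.σ m)ᵀ (mulVecL P x)‖ ^ 2 := by
    rw [qform_eq_inner, mulVecL_mul, mulVecL_mul, ← inner_mulVecL_comm hP, Sig, map_smul,
      smul_apply, inner_smul_right, mulVecL_mul, ← real_inner_self_eq_norm_sq,
      inner_mulVecL_left (p.σ m)ᵀ, Matrix.transpose_transpose]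
  rw [Phi, qform_add, qform_add, qform_add, left, right, quadratic]
  ring

theorem hamiltonian_eq_qform_Phi_sub (hγ : p.γ ≠ 0) (m : Fin M) {P : Matrix (Fin n) (Fin n) ℝ}
    (hP : Pᵀ = P) (x : EuclideanSpace ℝ (Fin n)) (w : EuclideanSpace ℝ (Fin k)) :
    1 / 2 * qform (p.D m) x - p.γ ^ 2 / 2 * ‖w‖ ^ 2 + ⟪mulVecL P x, p.velocity m x w⟫ =
      1 / 2 * qform (p.Phi m P) x - p.γ ^ 2 / 2 * ‖p.deviation m P x w‖ ^ 2 := by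
  have adjoint : ⟪mulVecL P x, mulVecL (p.σ m) w⟫ = ⟪w, mulVecL (p.σ m)ᵀ (mulVecL P x)⟫ := by
    rw [← inner_mulVecL_left, real_inner_comm]
  rw [qform_Phi m hP, deviation, velocity, @norm_sub_sq_real, inner_smul_right, norm_smul,
    inner_add_right, adjoint, Real.norm_of_nonneg (by positivity)]
  field_simp
  ring

theorem cost_add_qform_eq (hγ : p.γ ≠ 0) (hT : 0 ≤ T) (hw : IsDisturbance w) (hμ : Measurable μ)
    (hξ : p.IsTrajectory T x w μ ξ) {Q Q' : ℝ → Matrix (Fin n) (Fin n) ℝ}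
    (hQ : ∀ t ∈ Icc 0 T, HasDerivWithinAt Q (Q' t) (Icc 0 T) t) (hQ' : ContinuousOn Q' (Icc 0 T))
    (hsymm : ∀ t ∈ Icc 0 T, (Q t)ᵀ = Q t) :
    p.cost T w μ ξ + 1 / 2 * qform (Q T) (ξ T) = 1 / 2 * qform (Q 0) x +
      ∫ t in (0 : ℝ)..T, (1 / 2 * qform (p.Phi (μ t) (Q t) + Q' t) (ξ t) -
        p.γ ^ 2 / 2 * ‖p.deviation (μ t) (Q t) (ξ t) (w t)‖ ^ 2) := by
  have velocity_L2 := memLp_velocity (p := p) hw hμ hξ.1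
  have hQc : ContinuousOn Q (Icc 0 T) := fun t ht => (hQ t ht).continuousWithinAt
  have memLp_mul : ∀ {R : ℝ → Matrix (Fin n) (Fin n) ℝ}, ContinuousOn R (Icc 0 T) →
      MemLp (fun t => mulVecL (R t) (ξ t)) 2 (volume.restrict (Icc 0 T)) := fun hR =>
    memLp_Icc_of_continuousOn ((mulVecL.continuous.comp_continuousOn hR).clm_apply hξ.1) 2
  have cost_int := (intervalIntegrable_iff_integrableOn_Icc_of_le hT).2
    (integrableOn_cost (p := p) hw hμ hξ.1)
  have deriv_int : IntervalIntegrable (fun t => 2 * ⟪mulVecL (Q t) (ξ t),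
      p.velocity (μ t) (ξ t) (w t)⟫ + qform (Q' t) (ξ t)) volume 0 T := by
    rw [intervalIntegrable_iff_integrableOn_Icc_of_le hT]
    simp only [qform_eq_inner]
    exact ((integrable_inner_of_memLp_two (memLp_mul hQc) velocity_L2).const_mul _).add
      (integrable_inner_of_memLp_two (memLp_Icc_of_continuousOn hξ.1 2) (memLp_mul hQ'))
  rw [qform_eq_add_integral hT (intervalIntegrable_of_memLp_two hT velocity_L2)
      hξ.eq_add_integral hQ hQ' hsymm, cost, mul_add, add_left_comm,
    ← intervalIntegral.integral_const_mul,
    ← intervalIntegral.integral_add cost_int (deriv_int.const_mul _)]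
  congr 1
  refine intervalIntegral.integral_congr fun t ht => ?_
  rw [uIcc_of_le hT] at ht
  have := hamiltonian_eq_qform_Phi_sub hγ (μ t) (hsymm t ht) (ξ t) (w t)
  simp only [qform_add]
  linarith

end Verification

end SwitchedLQ

section AutonomousODE

variable {E : Type*} [NormedAddCommGroup E] [NormedSpace ℝ E] {y : ℝ → E} {T : ℝ}

theorem norm_sub_sub_smul_le_of_autonomous {f : E → E} {s : Set E} {K : NNReal} {B : ℝ}
    (hT : 0 ≤ T) (hf : LipschitzOnWith K f s) (hB : ∀ z ∈ s, ‖f z‖ ≤ B)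
    (hy : ∀ t ∈ Icc 0 T, HasDerivWithinAt y (f (y t)) (Icc 0 T) t)
    (hys : ∀ t ∈ Icc 0 T, y t ∈ s) :
    ‖y T - y 0 - T • f (y 0)‖ ≤ K * B * T ^ 2 := by
  have zero_mem : (0 : ℝ) ∈ Icc 0 T := left_mem_Icc.2 hT
  have B_nonneg : 0 ≤ B := (norm_nonneg _).trans (hB _ (hys 0 zero_mem))
  have displacement : ∀ t ∈ Icc 0 T, ‖y t - y 0‖ ≤ B * T := fun t ht =>
    calc ‖y t - y 0‖ ≤ B * ‖t - 0‖ := (convex_Icc 0 T).norm_image_sub_le_of_norm_hasDerivWithin_le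
          hy (fun s hs => hB _ (hys s hs)) zero_mem ht
      _ ≤ B * T := by rw [sub_zero, Real.norm_of_nonneg ht.1]; gcongr; exact ht.2
  have linearized : ∀ t ∈ Icc 0 T, HasDerivWithinAt (fun t => y t - t • f (y 0))
      (f (y t) - f (y 0)) (Icc 0 T) t := fun t ht => by
    simpa using (hy t ht).fun_sub ((hasDerivWithinAt_id t _).smul_const (f (y 0)))
  have deriv_le : ∀ t ∈ Icc 0 T, ‖f (y t) - f (y 0)‖ ≤ K * (B * T) := fun t ht =>
    (hf.norm_sub_le (hys t ht) (hys 0 zero_mem)).trans (by gcongr; exact displacement t ht)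
  have key := (convex_Icc 0 T).norm_image_sub_le_of_norm_hasDerivWithin_le linearized deriv_le
    zero_mem (right_mem_Icc.2 hT)
  calc ‖y T - y 0 - T • f (y 0)‖ = ‖y T - T • f (y 0) - (y 0 - (0 : ℝ) • f (y 0))‖ := by
        congr 1; simp only [zero_smul]; abel
    _ ≤ K * (B * T) * ‖T - 0‖ := key
    _ = K * B * T ^ 2 := by rw [sub_zero, Real.norm_of_nonneg hT]; ring

theorem exists_hasDerivAt_clm [CompleteSpace E] (L : E →L[ℝ] E) (x : E) :
    ∃ ξ : ℝ → E, ξ 0 = x ∧ ∀ t, HasDerivAt ξ (L (ξ t)) t := by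
  refine ⟨fun t => NormedSpace.exp (t • L) x, by simp, fun t => ?_⟩
  simpa using (hasDerivAt_exp_smul_const' L t).clm_apply (hasDerivAt_const t x)

end AutonomousODE

namespace SwitchedLQ

variable {n k M : ℕ} (p : SwitchedLQ n k M)

section Riccati

theorem contDiff_Phi (m : Fin M) : ContDiff ℝ 1 (p.Phi m) := by
  unfold Phi
  fun_prop

theorem exists_lipschitzOnWith_Phi (R : ℝ) : ∃ K, ∀ m,
    LipschitzOnWith K (p.Phi m) (Metric.closedBall 0 R) := by
  choose K hK using fun m => (p.contDiff_Phi m).contDiffOn.exists_lipschitzOnWith one_ne_zero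
    (convex_closedBall 0 R) (isCompact_closedBall 0 R)
  obtain ⟨K', hK'⟩ := Finite.exists_le K
  exact ⟨K', fun m => (hK m).weaken (hK' m)⟩

theorem exists_norm_Phi_le (R : ℝ) : ∃ B > 0, ∀ m, ∀ P ∈ Metric.closedBall 0 R,
    ‖p.Phi m P‖ ≤ B := by
  choose B hB using fun m => (isCompact_closedBall 0 R).exists_bound_of_continuousOn
    (p.contDiff_Phi m).continuous.continuousOn
  obtain ⟨B', hB'⟩ := Finite.exists_le B
  exact ⟨max B' 1, by positivity,
    fun m P hP => (hB m P hP).trans ((hB' m).trans (le_max_left _ _))⟩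

/-- Solutions on `[0, T]` of the Riccati equation of mode `m`. -/
def IsRiccatiSolution (m : Fin M) (T : ℝ) (P : ℝ → Matrix (Fin n) (Fin n) ℝ) : Prop :=
  ∀ t ∈ Icc 0 T, HasDerivWithinAt P (p.Phi m (P t)) (Icc 0 T) t

variable {p} {m : Fin M} {T : ℝ} {P : ℝ → Matrix (Fin n) (Fin n) ℝ}

theorem IsRiccatiSolution.continuousOn (hP : p.IsRiccatiSolution m T P) :
    ContinuousOn P (Icc 0 T) :=
  fun t ht => (hP t ht).continuousWithinAt

theorem IsRiccatiSolution.mono {t : ℝ} (hP : p.IsRiccatiSolution m T P) (ht : t ≤ T) :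
    p.IsRiccatiSolution m t P :=
  fun s hs => (hP s ⟨hs.1, hs.2.trans ht⟩).mono (Icc_subset_Icc_right ht)

theorem IsRiccatiSolution.hasDerivWithinAt_Ici (hP : p.IsRiccatiSolution m T P) {t : ℝ}
    (ht : t ∈ Ico 0 T) : HasDerivWithinAt P (p.Phi m (P t)) (Ici t) t :=
  (hP t (Ico_subset_Icc_self ht)).mono_of_mem_nhdsWithin (Icc_mem_nhdsGE_of_mem ht)

theorem IsRiccatiSolution.eqOn {Q : ℝ → Matrix (Fin n) (Fin n) ℝ}
    (hP : p.IsRiccatiSolution m T P) (hQ : p.IsRiccatiSolution m T Q) (h : P 0 = Q 0) :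
    EqOn P Q (Icc 0 T) := by
  obtain ⟨R, hR⟩ := isCompact_Icc.exists_bound_of_continuousOn hP.continuousOn
  obtain ⟨R', hR'⟩ := isCompact_Icc.exists_bound_of_continuousOn hQ.continuousOn
  obtain ⟨K, hK⟩ := p.exists_lipschitzOnWith_Phi (max R R')
  refine ODE_solution_unique_of_mem_Icc_right (v := fun _ => p.Phi m)
    (s := fun _ => Metric.closedBall 0 (max R R')) (fun _ _ => hK m)
    hP.continuousOn (fun t ht => hP.hasDerivWithinAt_Ici ht) (fun t ht => ?_)
    hQ.continuousOn (fun t ht => hQ.hasDerivWithinAt_Ici ht) (fun t ht => ?_) h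
  · exact mem_closedBall_zero_iff.2 ((hR t (Ico_subset_Icc_self ht)).trans (le_max_left _ _))
  · exact mem_closedBall_zero_iff.2 ((hR' t (Ico_subset_Icc_self ht)).trans (le_max_right _ _))

theorem IsInvariantInterval.exists_isRiccatiSolution {ε lam : ℝ}
    (h : p.IsInvariantInterval ε lam) (m : Fin M) (hT : 0 ≤ T)
    {P₀ : Matrix (Fin n) (Fin n) ℝ} (hP₀ : P₀ ∈ loewnerIcc n ε lam) :
    ∃ P, P 0 = P₀ ∧ p.IsRiccatiSolution m T P ∧ ∀ t ∈ Icc 0 T, P t ∈ loewnerIcc n ε lam := by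
  obtain ⟨-, -, P, hP₀', hP, -⟩ := h m T hT P₀ hP₀
  refine ⟨P, hP₀', hP, fun t ht => ?_⟩
  obtain ⟨Q, hQ, P', hP'₀, hP', rfl⟩ := h m t ht.1 P₀ hP₀
  have eq : P t = P' t := (IsRiccatiSolution.mono hP ht.2).eqOn hP' (hP₀'.trans hP'₀.symm)
    (right_mem_Icc.2 ht.1)
  exact eq ▸ hQ

variable (p) in
theorem exists_norm_sub_sub_smul_Phi_le (R : ℝ) : ∃ C ≥ 0, ∀ m T P, 0 ≤ T →
    p.IsRiccatiSolution m T P → (∀ t ∈ Icc 0 T, ‖P t‖ ≤ R) →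
    ‖P T - P 0 - T • p.Phi m (P 0)‖ ≤ C * T ^ 2 := by
  obtain ⟨K, hK⟩ := p.exists_lipschitzOnWith_Phi R
  obtain ⟨B, B_pos, hB⟩ := p.exists_norm_Phi_le R
  exact ⟨K * B, by positivity, fun m T P hT hP hPR => norm_sub_sub_smul_le_of_autonomous hT (hK m)
    (hB m) hP fun t ht => mem_closedBall_zero_iff.2 (hPR t ht)⟩

end Riccati

end SwitchedLQ

namespace SwitchedLQ

variable {n k M : ℕ} {p : SwitchedLQ n k M} {m : Fin M} {τ : ℝ} {x : EuclideanSpace ℝ (Fin n)}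
  {w : ℝ → EuclideanSpace ℝ (Fin k)} {ξ η : ℝ → EuclideanSpace ℝ (Fin n)}
  {P : ℝ → Matrix (Fin n) (Fin n) ℝ}

section SingleMode

theorem mulVecL_Sig (m : Fin M) (x : EuclideanSpace ℝ (Fin n)) :
    mulVecL (p.Sig m) x = mulVecL (p.σ m) ((1 / p.γ ^ 2) • mulVecL (p.σ m)ᵀ x) := by
  rw [Sig, map_smul, smul_apply, mulVecL_mul, map_smul]

theorem IsRiccatiSolution.hasDerivWithinAt_reverse (hP : p.IsRiccatiSolution m τ P) {t : ℝ}
    (ht : t ∈ Icc 0 τ) :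
    HasDerivWithinAt (fun t => P (τ - t)) (-p.Phi m (P (τ - t))) (Icc 0 τ) t := by
  have maps : MapsTo (fun t => τ - t) (Icc 0 τ) (Icc 0 τ) :=
    fun s hs => ⟨sub_nonneg.2 hs.2, sub_le_self τ hs.1⟩
  simpa [Function.comp_def] using
    (hP _ (maps ht)).scomp t ((hasDerivWithinAt_id t _).const_sub τ) maps

theorem IsRiccatiSolution.cost_add_qform_eq (hγ : p.γ ≠ 0) (hτ : 0 ≤ τ)
    (hP : p.IsRiccatiSolution m τ P) (hsymm : ∀ t ∈ Icc 0 τ, (P t)ᵀ = P t)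
    (hw : IsDisturbance w) (hξ : p.IsTrajectory τ x w (fun _ => m) ξ) :
    p.cost τ w (fun _ => m) ξ + 1 / 2 * qform (P 0) (ξ τ) = 1 / 2 * qform (P τ) x -
      p.γ ^ 2 / 2 * ∫ t in (0 : ℝ)..τ, ‖p.deviation m (P (τ - t)) (ξ t) (w t)‖ ^ 2 := by
  have reversed_cont : ContinuousOn (fun t => P (τ - t)) (Icc 0 τ) :=
    fun t ht => (hP.hasDerivWithinAt_reverse ht).continuousWithinAt
  have key := SwitchedLQ.cost_add_qform_eq hγ hτ hw measurable_const hξ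
    (fun t ht => hP.hasDerivWithinAt_reverse ht)
    ((p.contDiff_Phi m).continuous.comp_continuousOn reversed_cont).neg
    (fun t ht => hsymm _ ⟨sub_nonneg.2 ht.2, sub_le_self τ ht.1⟩)
  simp only [sub_self, sub_zero, add_neg_cancel] at key
  rw [key, sub_eq_add_neg, ← intervalIntegral.integral_const_mul,
    ← intervalIntegral.integral_neg]
  simp [qform_eq_inner]

variable (p) in
theorem exists_hamiltonian_flow (m : Fin M) (x y : EuclideanSpace ℝ (Fin n)) :
    ∃ ξ η : ℝ → EuclideanSpace ℝ (Fin n), ξ 0 = x ∧ η 0 = y ∧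
      (∀ t, HasDerivAt ξ (mulVecL (p.A m) (ξ t) + mulVecL (p.Sig m) (η t)) t) ∧
      ∀ t, HasDerivAt η (-(mulVecL (p.A m)ᵀ (η t) + mulVecL (p.D m) (ξ t))) t := by
  obtain ⟨ζ, hζ₀, hζ⟩ := exists_hasDerivAt_clm
    (((mulVecL (p.A m)).coprod (mulVecL (p.Sig m))).prod
      (-(mulVecL (p.D m)).coprod (mulVecL (p.A m)ᵀ))) (x, y)
  refine ⟨fun t => (ζ t).1, fun t => (ζ t).2, by simp [hζ₀], by simp [hζ₀],
    fun t => ?_, fun t => ?_⟩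
  · simpa [Function.comp_def] using
      (ContinuousLinearMap.fst ℝ _ _).hasFDerivAt.comp_hasDerivAt t (hζ t)
  · simpa [Function.comp_def, add_comm] using
      (ContinuousLinearMap.snd ℝ _ _).hasFDerivAt.comp_hasDerivAt t (hζ t)

/-- The costate of the Hamiltonian flow is `P ξ`: the defect `e = η - P ξ` solves the linear
equation `e' = -(A' + P Σ) e`. -/
theorem IsRiccatiSolution.costate_eq (hP : p.IsRiccatiSolution m τ P)
    (hξ : ∀ t, HasDerivAt ξ (mulVecL (p.A m) (ξ t) + mulVecL (p.Sig m) (η t)) t)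
    (hη : ∀ t, HasDerivAt η (-(mulVecL (p.A m)ᵀ (η t) + mulVecL (p.D m) (ξ t))) t)
    (h₀ : η 0 = mulVecL (P τ) (ξ 0)) :
    ∀ t ∈ Icc 0 τ, η t = mulVecL (P (τ - t)) (ξ t) := by
  set e := fun t => η t - mulVecL (P (τ - t)) (ξ t)
  set L := fun t => (p.A m)ᵀ + P (τ - t) * p.Sig m
  have reversed_cont : ContinuousOn (fun t => P (τ - t)) (Icc 0 τ) :=
    fun t ht => (hP.hasDerivWithinAt_reverse ht).continuousWithinAt
  have he : ∀ t ∈ Icc 0 τ, HasDerivWithinAt e (-mulVecL (L t) (e t)) (Icc 0 τ) t := by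
    intro t ht
    have hmul := (mulVecL.hasFDerivAt.comp_hasDerivWithinAt t
      (hP.hasDerivWithinAt_reverse ht)).clm_apply (hξ t).hasDerivWithinAt
    convert! (hη t).hasDerivWithinAt.sub hmul using 1
    simp only [e, L, Phi, Function.comp_apply, map_add, map_sub, map_neg, add_apply, neg_apply,
      mulVecL_mul]
    abel
  obtain ⟨K, hK⟩ := isCompact_Icc.exists_bound_of_continuousOn
    (continuousOn_const.add (reversed_cont.mul continuousOn_const) : ContinuousOn L (Icc 0 τ))
  have e_eq_zero := eq_zero_of_abs_deriv_le_mul_abs_self_of_eq_zero_right (K := K)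
    (fun t ht => (he t ht).continuousWithinAt)
    (fun t ht => (he t (Ico_subset_Icc_self ht)).mono_of_mem_nhdsWithin (Icc_mem_nhdsGE_of_mem ht))
    (by simp [e, h₀]) fun t ht => by
      rw [norm_neg]
      refine (norm_mulVecL_le _ _).trans ?_
      gcongr
      exact hK t (Ico_subset_Icc_self ht)
  exact fun t ht => sub_eq_zero.1 (e_eq_zero t ht)

theorem isTrajectory_of_hasDerivAt (hw : Continuous w)
    (hξ : ∀ t, HasDerivAt ξ (p.velocity m (ξ t) (w t)) t) :
    p.IsTrajectory τ (ξ 0) w (fun _ => m) ξ := by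
  have ξ_cont : Continuous ξ := continuous_iff_continuousAt.2 fun t => (hξ t).continuousAt
  have velocity_cont : Continuous fun t => p.velocity m (ξ t) (w t) :=
    ((mulVecL (p.A m)).continuous.comp ξ_cont).add ((mulVecL (p.σ m)).continuous.comp hw)
  refine ⟨ξ_cont.continuousOn, fun t _ => ?_⟩
  exact (add_eq_of_eq_sub' (intervalIntegral.integral_eq_sub_of_hasDerivAt (fun s _ => hξ s)
    (velocity_cont.intervalIntegrable 0 t))).symm

theorem IsRiccatiSolution.exists_isTrajectory_deviation_eq_zero
    (hP : p.IsRiccatiSolution m τ P) (x : EuclideanSpace ℝ (Fin n)) :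
    ∃ w ξ, IsDisturbance w ∧ p.IsTrajectory τ x w (fun _ => m) ξ ∧
      ∀ t ∈ Icc 0 τ, p.deviation m (P (τ - t)) (ξ t) (w t) = 0 := by
  obtain ⟨ξ, η, rfl, hη₀, hξ, hη⟩ := p.exists_hamiltonian_flow m x (mulVecL (P τ) x)
  have η_cont : Continuous η := continuous_iff_continuousAt.2 fun t => (hη t).continuousAt
  set w := fun t => (1 / p.γ ^ 2) • mulVecL (p.σ m)ᵀ (η t)
  have w_cont : Continuous w :=
    ((mulVecL (p.σ m)ᵀ).continuous.comp η_cont).const_smul (1 / p.γ ^ 2)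
  refine ⟨w, ξ, fun T => memLp_Icc_of_continuousOn w_cont.continuousOn 2,
    isTrajectory_of_hasDerivAt w_cont fun t => ?_, fun t ht => ?_⟩
  · simpa only [velocity, mulVecL_Sig] using hξ t
  · simp only [deviation, w, hP.costate_eq hξ hη hη₀ t ht, sub_self]

theorem IsRiccatiSolution.Sm_quadFun (hγ : p.γ ≠ 0) (hτ : 0 ≤ τ)
    (hP : p.IsRiccatiSolution m τ P) (hsymm : ∀ t ∈ Icc 0 τ, (P t)ᵀ = P t) :
    p.Sm m τ (quadFun (P 0)) = quadFun (P τ) := by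
  funext x
  refine le_antisymm (sSup_le ?_) ?_
  · rintro v ⟨w, ξ, hw, hξ, rfl⟩
    rw [payoff_quadFun, hP.cost_add_qform_eq hγ hτ hsymm hw hξ]
    refine EReal.coe_le_coe_iff.2 (sub_le_self _ (mul_nonneg (by positivity) ?_))
    exact intervalIntegral.integral_nonneg hτ fun t _ => sq_nonneg _
  · obtain ⟨w, ξ, hw, hξ, optimal⟩ := hP.exists_isTrajectory_deviation_eq_zero x
    refine le_sSup ⟨w, ξ, hw, hξ, ?_⟩
    have deviation_sq : ∫ t in (0 : ℝ)..τ, ‖p.deviation m (P (τ - t)) (ξ t) (w t)‖ ^ 2 = 0 := by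
      refine (intervalIntegral.integral_congr fun t ht => ?_).trans
        intervalIntegral.integral_zero
      rw [uIcc_of_le hτ] at ht
      simp [optimal t ht]
    rw [payoff_quadFun, hP.cost_add_qform_eq hγ hτ hsymm hw hξ, deviation_sq, mul_zero, sub_zero]
    rfl

end SingleMode

end SwitchedLQ

section ShortHorizon

theorem norm_sub_le_of_integrand_le {E : Type*} [NormedAddCommGroup E] [NormedSpace ℝ E]
    {ξ g : ℝ → E} {x : E} {d : ℝ → ℝ} {K T : ℝ} (hT : 0 ≤ T) (hK : 0 ≤ K) (hKT : K * T ≤ 1 / 2)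
    (hξ_cont : ContinuousOn ξ (Icc 0 T)) (hg : IntervalIntegrable g volume 0 T)
    (hd : IntervalIntegrable d volume 0 T)
    (hξ : ∀ t ∈ Icc 0 T, ξ t = x + ∫ s in (0 : ℝ)..t, g s)
    (hgd : ∀ s ∈ Icc 0 T, ‖g s‖ ≤ K * (‖ξ s‖ + d s)) :
    ∀ t ∈ Icc 0 T, ‖ξ t - x‖ ≤ 2 * K * (T * ‖x‖ + ∫ s in (0 : ℝ)..T, d s) := by
  obtain ⟨t₀, ht₀, hmax⟩ := isCompact_Icc.exists_isMaxOn (nonempty_Icc.2 hT)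
    (hξ_cont.sub (continuousOn_const (c := x))).norm
  set H := ‖ξ t₀ - x‖
  have le_H : ∀ t ∈ Icc 0 T, ‖ξ t - x‖ ≤ H := fun t ht => hmax ht
  have g_le : ∀ s ∈ Icc 0 T, ‖g s‖ ≤ K * (‖x‖ + H + d s) := fun s hs => by
    refine (hgd s hs).trans ?_
    gcongr
    linarith [norm_le_norm_add_norm_sub' (ξ s) x, le_H s hs]
  have self_bound : H ≤ K * (T * ‖x‖ + T * H + ∫ s in (0 : ℝ)..T, d s) :=
    calc H = ‖∫ s in (0 : ℝ)..t₀, g s‖ := by simp only [H, hξ t₀ ht₀, add_sub_cancel_left]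
      _ ≤ ∫ s in (0 : ℝ)..t₀, ‖g s‖ := intervalIntegral.norm_integral_le_integral_norm ht₀.1
      _ ≤ ∫ s in (0 : ℝ)..T, ‖g s‖ := intervalIntegral.integral_mono_interval le_rfl ht₀.1 ht₀.2
          (.of_forall fun _ => norm_nonneg _) hg.norm
      _ ≤ ∫ s in (0 : ℝ)..T, K * (‖x‖ + H + d s) := intervalIntegral.integral_mono_on hT hg.norm
          ((intervalIntegrable_const.add hd).const_mul _) g_le
      _ = K * (T * ‖x‖ + T * H + ∫ s in (0 : ℝ)..T, d s) := by
          rw [intervalIntegral.integral_const_mul,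
            intervalIntegral.integral_add intervalIntegrable_const hd,
            intervalIntegral.integral_const, sub_zero, smul_eq_mul]
          ring
  intro t ht
  have absorb : K * T * H ≤ 1 / 2 * H := by gcongr
  linarith [le_H t ht]

theorem eventually_mul_le_nhdsGT (a : ℝ) {b : ℝ} (hb : 0 < b) :
    ∀ᶠ τ in 𝓝[>] (0 : ℝ), a * τ ≤ b := by
  have : Tendsto (fun τ => a * τ) (𝓝[>] 0) (𝓝 (a * 0)) :=
    (tendsto_id.const_mul a).mono_left nhdsWithin_le_nhds
  rw [mul_zero] at this
  exact (this.eventually_lt_const hb).mono fun _ => le_of_lt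

theorem displacement_error_le {K B γ τ X V W : ℝ} (hK : 0 ≤ K) (hB : 0 ≤ B) (hτ : 0 ≤ τ)
    (hX : 0 ≤ X) (hV : 0 ≤ V) (hW : 0 ≤ W) (hVW : V ^ 2 ≤ τ * W) (hKτ : K * τ ≤ 1 / 2)
    (hKBτ : 12 * K * B * τ ≤ γ ^ 2) :
    τ * (B * (2 * X * (2 * K * (τ * X + V)) + (2 * K * (τ * X + V)) ^ 2)) ≤
      12 * K * B * τ ^ 2 * X ^ 2 + γ ^ 2 * W := by
  set Y := τ * X + V with hY
  have cross : τ * X * Y ≤ Y * Y := by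
    gcongr
    exact le_add_of_nonneg_right hV
  have Y_sq : Y ^ 2 ≤ 2 * (τ ^ 2 * X ^ 2 + V ^ 2) := by
    rw [hY, ← mul_pow]
    exact add_sq_le
  calc τ * (B * (2 * X * (2 * K * Y) + (2 * K * Y) ^ 2))
      = 4 * K * B * (τ * X * Y) + 4 * K * B * (K * τ) * Y ^ 2 := by ring
    _ ≤ 4 * K * B * (Y * Y) + 4 * K * B * (1 / 2) * Y ^ 2 := by gcongr
    _ = 6 * K * B * Y ^ 2 := by ring
    _ ≤ 6 * K * B * (2 * (τ ^ 2 * X ^ 2 + τ * W)) := by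
        gcongr
        exact Y_sq.trans (by gcongr)
    _ = 12 * K * B * τ ^ 2 * X ^ 2 + 12 * K * B * τ * W := by ring
    _ ≤ 12 * K * B * τ ^ 2 * X ^ 2 + γ ^ 2 * W := by gcongr

end ShortHorizon

namespace SwitchedLQ

variable {n k M : ℕ} {p : SwitchedLQ n k M} {τ : ℝ} {x : EuclideanSpace ℝ (Fin n)}
  {w : ℝ → EuclideanSpace ℝ (Fin k)} {μ : ℝ → Fin M} {ξ : ℝ → EuclideanSpace ℝ (Fin n)}
  {P : Matrix (Fin n) (Fin n) ℝ}

section ShortHorizon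

theorem velocity_eq_add_deviation (m : Fin M) (P : Matrix (Fin n) (Fin n) ℝ)
    (x : EuclideanSpace ℝ (Fin n)) (w : EuclideanSpace ℝ (Fin k)) :
    p.velocity m x w =
      mulVecL (p.A m + p.Sig m * P) x + mulVecL (p.σ m) (p.deviation m P x w) := by
  simp only [velocity, deviation, map_add, add_apply, map_sub, mulVecL_mul, mulVecL_Sig]
  abel

variable (p) in
theorem exists_norm_velocity_le (R : ℝ) : ∃ K > 0, ∀ m P x w, ‖P‖ ≤ R →
    ‖p.velocity m x w‖ ≤ K * (‖x‖ + ‖p.deviation m P x w‖) := by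
  obtain ⟨a, ha⟩ := Finite.exists_le fun m => ‖p.A m‖ + ‖p.Sig m‖ * R
  obtain ⟨b, hb⟩ := Finite.exists_le fun m => ‖p.σ m‖
  refine ⟨max 1 (max a b), by positivity, fun m P x w hP => ?_⟩
  have drift : ‖p.A m + p.Sig m * P‖ ≤ max 1 (max a b) :=
    calc ‖p.A m + p.Sig m * P‖ ≤ ‖p.A m‖ + ‖p.Sig m‖ * ‖P‖ :=
          (norm_add_le _ _).trans (by gcongr; exact norm_mul_le _ _)
      _ ≤ ‖p.A m‖ + ‖p.Sig m‖ * R := by gcongr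
      _ ≤ max 1 (max a b) := (ha m).trans ((le_max_left a b).trans (le_max_right _ _))
  have noise : ‖p.σ m‖ ≤ max 1 (max a b) :=
    (hb m).trans ((le_max_right a b).trans (le_max_right _ _))
  rw [velocity_eq_add_deviation m P, mul_add]
  refine (norm_add_le _ _).trans (add_le_add ?_ ?_) <;>
    exact (norm_mulVecL_le _ _).trans (by gcongr)

theorem cost_add_qform_le (hγ : p.γ ≠ 0) (hτ : 0 ≤ τ) (hP : Pᵀ = P) (hw : IsDisturbance w)
    (hμ : Measurable μ) (hξ : p.IsTrajectory τ x w μ ξ) {B H c : ℝ}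
    (hB : ∀ m, ‖p.Phi m P‖ ≤ B) (hH : ∀ t ∈ Icc 0 τ, ‖ξ t - x‖ ≤ H)
    (hc : ∀ m, qform (p.Phi m P) x ≤ c) :
    p.cost τ w μ ξ + 1 / 2 * qform P (ξ τ) ≤ 1 / 2 * (qform P x + τ * c +
      τ * (B * (2 * ‖x‖ * H + H ^ 2)) -
      p.γ ^ 2 * ∫ t in (0 : ℝ)..τ, ‖p.deviation (μ t) P (ξ t) (w t)‖ ^ 2) := by
  have ξ_L2 := memLp_Icc_of_continuousOn hξ.1 2
  have Phi_int : IntervalIntegrable (fun t => qform (p.Phi (μ t) P) (ξ t)) volume 0 τ := by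
    rw [intervalIntegrable_iff_integrableOn_Icc_of_le hτ]
    simp only [qform_eq_inner]
    exact integrable_inner_of_memLp_two ξ_L2 (memLp_mulVecL_comp (fun m => p.Phi m P) hμ ξ_L2)
  have deviation_int : IntervalIntegrable
      (fun t => ‖p.deviation (μ t) P (ξ t) (w t)‖ ^ 2) volume 0 τ :=
    (intervalIntegrable_iff_integrableOn_Icc_of_le hτ).2
      ((memLp_deviation hw hμ hξ.1 P).integrable_norm_pow two_ne_zero)
  have Phi_le : ∀ t ∈ Icc 0 τ,
      qform (p.Phi (μ t) P) (ξ t) ≤ c + B * (2 * ‖x‖ * H + H ^ 2) := fun t ht =>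
    calc qform (p.Phi (μ t) P) (ξ t) ≤ qform (p.Phi (μ t) P) x +
          ‖p.Phi (μ t) P‖ * (2 * ‖x‖ * ‖ξ t - x‖ + ‖ξ t - x‖ ^ 2) := qform_le_add_norm _ _ _
      _ ≤ c + B * (2 * ‖x‖ * H + H ^ 2) := by
          have hHt := hH t ht
          gcongr
          exacts [hc _, (norm_nonneg _).trans (hB (μ t)), hB _]
  have integral_le := intervalIntegral.integral_mono_on hτ Phi_int intervalIntegrable_const Phi_le
  have verification := cost_add_qform_eq hγ hτ hw hμ hξ (Q := fun _ => P) (Q' := fun _ => 0)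
    (fun t _ => hasDerivWithinAt_const _ _ _) continuousOn_const (fun _ _ => hP)
  simp only [add_zero] at verification
  rw [verification, intervalIntegral.integral_sub (Phi_int.const_mul _)
    (deviation_int.const_mul _), intervalIntegral.integral_const_mul,
    intervalIntegral.integral_const_mul]
  rw [intervalIntegral.integral_const, sub_zero, smul_eq_mul] at integral_le
  linarith

variable (p) in
theorem exists_S_quadFun_le (hγ : p.γ ≠ 0) (R : ℝ) : ∃ C > 0, ∀ᶠ τ in 𝓝[>] (0 : ℝ),
    ∀ P x c, Pᵀ = P → ‖P‖ ≤ R → (∀ m, qform (p.Phi m P) x ≤ c) → p.S τ (quadFun P) x ≤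
      ((1 / 2 * (qform P x + τ * c + C * τ ^ 2 * ‖x‖ ^ 2) : ℝ) : EReal) := by
  obtain ⟨B, hB, hPhi⟩ := p.exists_norm_Phi_le R
  obtain ⟨K, hK, hvelocity⟩ := p.exists_norm_velocity_le R
  refine ⟨12 * K * B, by positivity, ?_⟩
  filter_upwards [self_mem_nhdsWithin, eventually_mul_le_nhdsGT K one_half_pos,
    eventually_mul_le_nhdsGT (12 * K * B) (b := p.γ ^ 2) (by positivity)]
    with τ hτ hKτ hKBτ P x c hP hPR hc
  refine sSup_le ?_
  rintro v ⟨w, μ, ξ, hw, hμ, hξ, rfl⟩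
  rw [payoff_quadFun]
  refine EReal.coe_le_coe_iff.2 ?_
  have hτ₀ : 0 ≤ τ := le_of_lt hτ
  have deviation_L2 := memLp_deviation (p := p) hw hμ hξ.1 P
  have deviation_int := (intervalIntegrable_of_memLp_two hτ₀ deviation_L2).norm
  have displacement := norm_sub_le_of_integrand_le hτ₀ hK.le hKτ hξ.1
    (intervalIntegrable_of_memLp_two hτ₀ (memLp_velocity hw hμ hξ.1)) deviation_int
    hξ.eq_add_integral fun s _ => hvelocity _ _ _ _ hPR
  have cauchy_schwarz := sq_intervalIntegral_le hτ deviation_int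
    ((intervalIntegrable_iff_integrableOn_Icc_of_le hτ₀).2
      (deviation_L2.integrable_norm_pow two_ne_zero))
  rw [sub_zero] at cauchy_schwarz
  have error_le := displacement_error_le hK.le hB.le hτ₀ (norm_nonneg x)
    (intervalIntegral.integral_nonneg hτ₀ fun _ _ => norm_nonneg _)
    (intervalIntegral.integral_nonneg hτ₀ fun _ _ => sq_nonneg _) cauchy_schwarz hKτ hKBτ
  refine (cost_add_qform_le hγ hτ₀ hP hw hμ hξ
    (fun m => hPhi m P (mem_closedBall_zero_iff.2 hPR)) displacement hc).trans ?_
  linarith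

end ShortHorizon

end SwitchedLQ

namespace SwitchedLQ

variable {n k M : ℕ} {p : SwitchedLQ n k M} {a T : ℝ} {x : EuclideanSpace ℝ (Fin n)}
  {w : ℝ → EuclideanSpace ℝ (Fin k)} {μ : ℝ → Fin M} {ξ : ℝ → EuclideanSpace ℝ (Fin n)}

section DynamicProgramming

theorem IsDisturbance.comp_add_right (hw : IsDisturbance w) (ha : 0 ≤ a) :
    IsDisturbance fun t => w (t + a) := by
  intro T
  have shift := (measurePreserving_add_right (volume : Measure ℝ) a).restrict_preimage
    (measurableSet_Icc (a := a) (b := T + a))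
  rw [preimage_add_const_Icc, sub_self, add_sub_cancel_right] at shift
  exact ((hw (T + a)).mono_measure
    (Measure.restrict_mono (Icc_subset_Icc_left ha) le_rfl)).comp_measurePreserving shift

theorem IsTrajectory.mono (haT : a ≤ T) (h : p.IsTrajectory T x w μ ξ) :
    p.IsTrajectory a x w μ ξ :=
  ⟨h.1.mono (Icc_subset_Icc_right haT), fun t ht => h.2 t (Icc_subset_Icc_right haT ht)⟩

theorem IsTrajectory.comp_add_right (ha : 0 ≤ a) (hw : IsDisturbance w) (hμ : Measurable μ)
    (h : p.IsTrajectory (a + T) x w μ ξ) :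
    p.IsTrajectory T (ξ a) (fun t => w (t + a)) (fun t => μ (t + a)) fun t => ξ (t + a) := by
  have mem : ∀ t ∈ Icc 0 T, t + a ∈ Icc 0 (a + T) := fun t ht =>
    ⟨add_nonneg ht.1 ha, by linarith [ht.2]⟩
  refine ⟨h.1.comp (by fun_prop) mem, fun t ht => ?_⟩
  have aT_nonneg : 0 ≤ a + T := (mem t ht).1.trans (mem t ht).2
  have a_mem : a ∈ Icc 0 (a + T) := ⟨ha, by linarith [ht.1.trans ht.2]⟩
  have velocity_int : ∀ s ∈ Icc 0 (a + T), IntervalIntegrable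
      (fun t => p.velocity (μ t) (ξ t) (w t)) volume 0 s := fun s hs =>
    (intervalIntegrable_of_memLp_two aT_nonneg (memLp_velocity hw hμ h.1)).mono_set
      (uIcc_subset_uIcc_left (Icc_subset_uIcc hs))
  calc ξ (t + a) = ξ a + ∫ s in a..t + a, p.velocity (μ s) (ξ s) (w s) := by
        rw [← intervalIntegral.integral_interval_sub_left (velocity_int _ (mem t ht))
          (velocity_int a a_mem), h.eq_add_integral _ (mem t ht), h.eq_add_integral a a_mem]
        abel
    _ = ξ a + ∫ s in (0 : ℝ)..t, p.velocity (μ (s + a)) (ξ (s + a)) (w (s + a)) := by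
        rw [intervalIntegral.integral_comp_add_right
          (fun s => p.velocity (μ s) (ξ s) (w s)), zero_add]

theorem cost_add (ha : 0 ≤ a) (hT : 0 ≤ T) (hw : IsDisturbance w) (hμ : Measurable μ)
    (hξ : ContinuousOn ξ (Icc 0 (a + T))) :
    p.cost (a + T) w μ ξ = p.cost a w μ ξ +
      p.cost T (fun t => w (t + a)) (fun t => μ (t + a)) fun t => ξ (t + a) := by
  have cost_int := (intervalIntegrable_iff_integrableOn_Icc_of_le (add_nonneg ha hT)).2
    (integrableOn_cost (p := p) hw hμ hξ)
  have a_mem : a ∈ uIcc 0 (a + T) := Icc_subset_uIcc ⟨ha, by linarith⟩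
  rw [cost, cost, cost, intervalIntegral.integral_comp_add_right
    (fun t => 1 / 2 * qform (p.D (μ t)) (ξ t) - p.γ ^ 2 / 2 * ‖w t‖ ^ 2), zero_add, add_comm T a,
    intervalIntegral.integral_add_adjacent_intervals
      (cost_int.mono_set (uIcc_subset_uIcc_left a_mem))
      (cost_int.mono_set (uIcc_subset_uIcc_right a_mem))]

variable (p)

theorem S_mono (T : ℝ) : Monotone (p.S T) := by
  intro V W hVW x
  refine sSup_le ?_
  rintro v ⟨w, μ, ξ, hw, hμ, hξ, rfl⟩
  exact (add_le_add_right (hVW _) _).trans (le_sSup ⟨w, μ, ξ, hw, hμ, hξ, rfl⟩)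

theorem Sm_le_S (m : Fin M) (T : ℝ) (V : EuclideanSpace ℝ (Fin n) → EReal) :
    p.Sm m T V ≤ p.S T V := by
  refine fun x => sSup_le ?_
  rintro v ⟨w, ξ, hw, hξ, rfl⟩
  exact le_sSup ⟨w, _, ξ, hw, measurable_const, hξ, rfl⟩

theorem S_zero_le (V : EuclideanSpace ℝ (Fin n) → EReal) : p.S 0 V ≤ V := by
  refine fun x => sSup_le ?_
  rintro v ⟨w, μ, ξ, -, -, hξ, rfl⟩
  have start : ξ 0 = x := by simpa using hξ.2 0 (left_mem_Icc.2 le_rfl)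
  simp [payoff, start]

theorem S_add_le (ha : 0 ≤ a) (hT : 0 ≤ T) (V : EuclideanSpace ℝ (Fin n) → EReal) :
    p.S (a + T) V ≤ p.S a (p.S T V) := by
  refine fun x => sSup_le ?_
  rintro v ⟨w, μ, ξ, hw, hμ, hξ, rfl⟩
  have tail : (p.cost T (fun t => w (t + a)) (fun t => μ (t + a)) (fun t => ξ (t + a)) : EReal) +
      V (ξ (a + T)) ≤ p.S T V (ξ a) := by
    rw [add_comm a T]
    exact le_sSup ⟨_, _, fun t => ξ (t + a), hw.comp_add_right ha, hμ.comp (measurable_add_const a),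
      hξ.comp_add_right ha hw hμ, rfl⟩
  calc p.payoff (a + T) V w μ ξ
      = p.cost a w μ ξ + (p.cost T (fun t => w (t + a)) (fun t => μ (t + a))
          (fun t => ξ (t + a)) + V (ξ (a + T))) := by
        rw [payoff_eq_cost_add, cost_add ha hT hw hμ hξ.1, EReal.coe_add, add_assoc]
    _ ≤ p.payoff a (p.S T V) w μ ξ := add_le_add_right tail _
    _ ≤ p.S a (p.S T V) x :=
        le_sSup ⟨w, μ, ξ, hw, hμ, hξ.mono (le_add_of_nonneg_right hT), rfl⟩

end DynamicProgramming

end SwitchedLQ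

namespace SwitchedLQ

variable {n k M : ℕ}

section Subhomogeneity

/-- Along rays through quadratic forms of norm at most `Λ`, the Riccati fields `Φ_m` are strictly
subhomogeneous: scaling `P` by `1 + θ` with `θ ∈ [0, θ₁]` loses `θ η I` against scaling `Φ_m(P)`.
This is what makes the Riccati flow, and hence one time step, contract relative errors. -/
def IsStrictlySubhomogeneous (p : SwitchedLQ n k M) (Λ η θ₁ : ℝ) : Prop :=
  ∀ m (P : Matrix (Fin n) (Fin n) ℝ) x, ‖P‖ ≤ Λ → ∀ θ ∈ Icc 0 θ₁,
    qform (p.Phi m ((1 + θ) • P)) x ≤ (1 + θ) * qform (p.Phi m P) x - θ * η * ‖x‖ ^ 2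

theorem Phi_smul (p : SwitchedLQ n k M) (m : Fin M) (c : ℝ) (P : Matrix (Fin n) (Fin n) ℝ) :
    p.Phi m (c • P) =
      c • p.Phi m P + (c * (c - 1)) • (P * p.Sig m * P) - (c - 1) • p.D m := by
  simp only [Phi, Matrix.mul_smul, Matrix.smul_mul, smul_add, smul_smul]
  module

theorem norm_Sig_le {p : SwitchedLQ n k M} {cσ : ℝ} {m : Fin M} (hσ : ‖p.σ m‖ ≤ cσ) :
    ‖p.Sig m‖ ≤ cσ ^ 2 / p.γ ^ 2 := by
  have cσ_nonneg := (norm_nonneg _).trans hσ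
  calc ‖p.Sig m‖ ≤ 1 / p.γ ^ 2 * (‖p.σ m‖ * ‖(p.σ m)ᵀ‖) := by
        rw [Sig, norm_smul, Real.norm_of_nonneg (by positivity)]
        gcongr
        exact Matrix.l2_opNorm_mul _ _
    _ ≤ 1 / p.γ ^ 2 * (cσ * cσ) := by
        rw [norm_transpose_eq]
        gcongr
    _ = cσ ^ 2 / p.γ ^ 2 := by ring

theorem qform_mul_Sig_mul_le {p : SwitchedLQ n k M} {cσ Λ : ℝ} {m : Fin M}
    (hσ : ‖p.σ m‖ ≤ cσ) {P : Matrix (Fin n) (Fin n) ℝ} (hP : ‖P‖ ≤ Λ)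
    (x : EuclideanSpace ℝ (Fin n)) :
    qform (P * p.Sig m * P) x ≤ cσ ^ 2 / p.γ ^ 2 * Λ ^ 2 * ‖x‖ ^ 2 := by
  have Λ_nonneg := (norm_nonneg _).trans hP
  have norm_le : ‖P * p.Sig m * P‖ ≤ cσ ^ 2 / p.γ ^ 2 * Λ ^ 2 :=
    calc ‖P * p.Sig m * P‖ ≤ ‖P‖ * ‖p.Sig m‖ * ‖P‖ :=
          norm_mul₃_le
      _ ≤ Λ * (cσ ^ 2 / p.γ ^ 2) * Λ := by gcongr; exact norm_Sig_le hσ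
      _ = cσ ^ 2 / p.γ ^ 2 * Λ ^ 2 := by ring
  exact (le_abs_self _).trans ((abs_qform_le _ x).trans (by gcongr))

theorem lt_lam2_iff {p : SwitchedLQ n k M} (hγ : p.γ ≠ 0) {cσ mD Λ : ℝ} (hcσ : 0 < cσ)
    (hΛ : 0 ≤ Λ) : Λ < p.lam2 cσ mD ↔ cσ ^ 2 / p.γ ^ 2 * Λ ^ 2 < mD := by
  have γ_sq_pos : 0 < p.γ ^ 2 := by positivity
  rw [lam2, Real.lt_sqrt hΛ, lt_div_iff₀ (by positivity), div_mul_eq_mul_div,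
    div_lt_iff₀ γ_sq_pos, mul_comm]

theorem exists_isStrictlySubhomogeneous {p : SwitchedLQ n k M} (hγ : p.γ ≠ 0) {cσ mD Λ : ℝ}
    (hcσ : 0 < cσ) (hσ : ∀ m, ‖p.σ m‖ ≤ cσ) (hD : ∀ m x, mD * ‖x‖ ^ 2 ≤ qform (p.D m) x)
    (hΛ : 0 < Λ) (hΛ_lt : Λ < p.lam2 cσ mD) :
    ∃ η > 0, ∃ θ₁ ∈ Ioc (0 : ℝ) 1, p.IsStrictlySubhomogeneous Λ η θ₁ := by
  set b := cσ ^ 2 / p.γ ^ 2 * Λ ^ 2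
  have b_pos : 0 < b := by positivity
  have b_lt : b < mD := (lt_lam2_iff hγ hcσ hΛ.le).1 hΛ_lt
  set η := (mD - b) / 2 with hη
  have η_pos : 0 < η := by linarith
  refine ⟨η, η_pos, min 1 (η / b), ⟨by positivity, min_le_left _ _⟩, fun m P x hP θ hθ => ?_⟩
  have θb_le : θ * b ≤ η := (le_div_iff₀ b_pos).1 (hθ.2.trans (min_le_right _ _))
  have loss : (1 + θ) * (b * ‖x‖ ^ 2) - mD * ‖x‖ ^ 2 ≤ -(η * ‖x‖ ^ 2) :=
    calc (1 + θ) * (b * ‖x‖ ^ 2) - mD * ‖x‖ ^ 2 = (b + θ * b - mD) * ‖x‖ ^ 2 := by ring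
      _ ≤ -η * ‖x‖ ^ 2 := by gcongr; linarith
      _ = -(η * ‖x‖ ^ 2) := by ring
  have one_add_nonneg : 0 ≤ 1 + θ := by linarith [hθ.1]
  calc qform (p.Phi m ((1 + θ) • P)) x
      = (1 + θ) * qform (p.Phi m P) x +
          θ * ((1 + θ) * qform (P * p.Sig m * P) x - qform (p.D m) x) := by
        rw [Phi_smul, qform_sub, qform_add, qform_smul, qform_smul, qform_smul]
        ring
    _ ≤ (1 + θ) * qform (p.Phi m P) x +
          θ * ((1 + θ) * (b * ‖x‖ ^ 2) - mD * ‖x‖ ^ 2) := by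
        gcongr
        · exact hθ.1
        · exact qform_mul_Sig_mul_le (hσ m) hP x
        · exact hD m x
    _ ≤ (1 + θ) * qform (p.Phi m P) x + θ * -(η * ‖x‖ ^ 2) := by
        gcongr
        exact hθ.1
    _ = (1 + θ) * qform (p.Phi m P) x - θ * η * ‖x‖ ^ 2 := by ring

end Subhomogeneity

end SwitchedLQ

namespace SwitchedLQ

variable {n k M : ℕ} {p : SwitchedLQ n k M} {ε lam : ℝ}

section OneStep

theorem IsInvariantInterval.exists_Sm_quadFun_eq (h : p.IsInvariantInterval ε lam)
    (hγ : p.γ ≠ 0) (hε : 0 ≤ ε) : ∃ C ≥ 0, ∀ m τ P, 0 ≤ τ → P ∈ loewnerIcc n ε lam →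
      ∃ Q ∈ loewnerIcc n ε lam, p.Sm m τ (quadFun P) = quadFun Q ∧
        ∀ x, qform P x + τ * qform (p.Phi m P) x ≤ qform Q x + C * τ ^ 2 * ‖x‖ ^ 2 := by
  obtain ⟨C, hC, euler⟩ := p.exists_norm_sub_sub_smul_Phi_le |lam|
  refine ⟨C, hC, fun m τ P₀ hτ hP₀ => ?_⟩
  obtain ⟨P, rfl, hP, hmem⟩ := h.exists_isRiccatiSolution m hτ hP₀
  refine ⟨P τ, hmem τ (right_mem_Icc.2 hτ),
    hP.Sm_quadFun hγ hτ fun t ht => (mem_loewnerIcc_iff.1 (hmem t ht)).1, fun x => ?_⟩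
  have remainder : |qform (P τ - P 0 - τ • p.Phi m (P 0)) x| ≤ C * τ ^ 2 * ‖x‖ ^ 2 := by
    refine (abs_qform_le _ x).trans ?_
    gcongr
    exact euler m τ P hτ hP fun t ht =>
      norm_le_of_mem_loewnerIcc hε (abs_nonneg lam) (le_abs_self lam) (hmem t ht)
  rw [qform_sub, qform_sub, qform_smul] at remainder
  linarith [neg_abs_le (qform (P τ) x - qform (P 0) x - τ * qform (p.Phi m (P 0)) x)]

theorem one_step_factor_nonneg {α θ τ C : ℝ} (hθ : 0 ≤ θ) (hατ : α * τ ≤ 1) (hC : 0 ≤ C) :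
    0 ≤ 1 + θ * (1 - α * τ) + C * τ ^ 2 := by
  have := mul_nonneg hθ (sub_nonneg.2 hατ)
  positivity

theorem one_step_factor_le {s φ q τ θ η Λ X C₁ C₂ : ℝ} (hε : 0 < ε) (hΛ : 0 < Λ) (hη : 0 ≤ η)
    (hτ : 0 ≤ τ) (hθ : θ ∈ Icc 0 1) (hX : 0 ≤ X) (hC₁ : 0 ≤ C₁) (hC₂ : 0 ≤ C₂)
    (h_step : s + τ * φ ≤ q + C₂ * τ ^ 2 * X) (h_lower : ε * X ≤ q) (h_upper : q ≤ Λ * X) :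
    (1 + θ) * s + τ * ((1 + θ) * φ - θ * η * X) + C₁ * τ ^ 2 * X ≤
      (1 + θ * (1 - η / Λ * τ) + (C₁ + 2 * C₂) / ε * τ ^ 2) * q := by
  obtain ⟨θ_nonneg, θ_le⟩ := hθ
  have gain : θ * (η / Λ * τ) * q ≤ θ * τ * η * X :=
    calc θ * (η / Λ * τ) * q ≤ θ * (η / Λ * τ) * (Λ * X) := by gcongr
      _ = θ * τ * η * X := by field_simp
  have X_le : X ≤ q / ε := (le_div_iff₀' hε).2 h_lower
  calc (1 + θ) * s + τ * ((1 + θ) * φ - θ * η * X) + C₁ * τ ^ 2 * X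
      = (1 + θ) * (s + τ * φ) - θ * τ * η * X + C₁ * τ ^ 2 * X := by ring
    _ ≤ (1 + θ) * (q + C₂ * τ ^ 2 * X) - θ * (η / Λ * τ) * q + C₁ * τ ^ 2 * X := by gcongr
    _ = (1 + θ) * q - θ * (η / Λ * τ) * q + (C₁ + (1 + θ) * C₂) * τ ^ 2 * X := by ring
    _ ≤ (1 + θ) * q - θ * (η / Λ * τ) * q + (C₁ + (1 + 1) * C₂) * τ ^ 2 * (q / ε) := by gcongr
    _ = (1 + θ * (1 - η / Λ * τ) + (C₁ + 2 * C₂) / ε * τ ^ 2) * q := by ring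

theorem coe_mul_quadFun (c : ℝ) (P : Matrix (Fin n) (Fin n) ℝ) (x : EuclideanSpace ℝ (Fin n)) :
    (c : EReal) * quadFun P x = quadFun (c • P) x := by
  rw [quadFun, quadFun, qform_smul, ← EReal.coe_mul]
  ring_nf

theorem IsInvariantInterval.exists_S_smul_le_mul_tildeS [Nonempty (Fin M)]
    (h : p.IsInvariantInterval ε lam) (hγ : p.γ ≠ 0) (hε : 0 < ε) {Λ η θ₁ : ℝ} (hΛ : 0 < Λ)
    (hlam : lam ≤ Λ) (hη : 0 < η) (hθ₁ : θ₁ ≤ 1) (hsub : p.IsStrictlySubhomogeneous Λ η θ₁) :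
    ∃ α > 0, ∃ C > 0, ∀ᶠ τ in 𝓝[>] (0 : ℝ), ∀ θ ∈ Icc 0 θ₁, ∀ P ∈ loewnerIcc n ε lam, ∀ x,
      p.S τ (quadFun ((1 + θ) • P)) x ≤
        ((1 + θ * (1 - α * τ) + C * τ ^ 2 : ℝ) : EReal) * p.tildeS τ (quadFun P) x := by
  obtain ⟨C₁, hC₁, upper⟩ := p.exists_S_quadFun_le hγ (2 * Λ)
  obtain ⟨C₂, hC₂, lower⟩ := h.exists_Sm_quadFun_eq hγ hε.le
  refine ⟨η / Λ, by positivity, (C₁ + 2 * C₂) / ε, by positivity, ?_⟩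
  filter_upwards [upper, self_mem_nhdsWithin, eventually_mul_le_nhdsGT (η / Λ) one_pos]
    with τ upper hτ hατ θ hθ P hP x
  have τ_pos : 0 < τ := hτ
  have norm_P_le : ‖P‖ ≤ Λ := norm_le_of_mem_loewnerIcc hε.le hΛ.le hlam hP
  have norm_smul_P_le : ‖(1 + θ) • P‖ ≤ 2 * Λ := by
    rw [norm_smul, Real.norm_of_nonneg (by linarith [hθ.1])]
    gcongr
    linarith [hθ.2]
  obtain ⟨m, hm⟩ := Finite.exists_max fun m => qform (p.Phi m ((1 + θ) • P)) x
  obtain ⟨Q, hQ, hSm, hQP⟩ := lower m τ P τ_pos.le hP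
  have hQx := (mem_loewnerIcc_iff.1 hQ).2 x
  have factor := one_step_factor_le hε hΛ hη.le τ_pos.le ⟨hθ.1, hθ.2.trans hθ₁⟩
    (sq_nonneg ‖x‖) hC₁.le hC₂ (hQP x) hQx.1 (hQx.2.trans (by gcongr))
  have ρ_nonneg := one_step_factor_nonneg (C := (C₁ + 2 * C₂) / ε) hθ.1 hατ (by positivity)
  calc p.S τ (quadFun ((1 + θ) • P)) x
      ≤ ((1 / 2 * (qform ((1 + θ) • P) x + τ * qform (p.Phi m ((1 + θ) • P)) x +
          C₁ * τ ^ 2 * ‖x‖ ^ 2) : ℝ) : EReal) :=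
        upper _ x _ (by rw [Matrix.transpose_smul, (mem_loewnerIcc_iff.1 hP).1])
          norm_smul_P_le hm
    _ ≤ ((1 / 2 * ((1 + θ) * qform P x + τ * ((1 + θ) * qform (p.Phi m P) x -
          θ * η * ‖x‖ ^ 2) + C₁ * τ ^ 2 * ‖x‖ ^ 2) : ℝ) : EReal) := by
        rw [qform_smul]
        gcongr
        exact hsub m P x norm_P_le θ hθ
    _ ≤ ((1 + θ * (1 - η / Λ * τ) + (C₁ + 2 * C₂) / ε * τ ^ 2 : ℝ) : EReal) * quadFun Q x := by
        rw [coe_mul_quadFun, quadFun, qform_smul]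
        gcongr
    _ ≤ _ := by
        gcongr
        exact hSm ▸ le_iSup (fun m => p.Sm m τ (quadFun P) x) m

end OneStep

end SwitchedLQ

section Pruning

variable {n : ℕ} {F : Finset (EuclideanSpace ℝ (Fin n) → EReal)}

theorem exists_mem_sup_id_apply_eq {X α : Type*} [LinearOrder α] [OrderBot α]
    {F : Finset (X → α)} (hF : F.Nonempty) (x : X) : ∃ f ∈ F, F.sup id x = f x := by
  rw [Finset.sup_apply]
  exact F.exists_mem_eq_sup hF fun f => f x

theorem quadFun_nonneg {P : Matrix (Fin n) (Fin n) ℝ} (hP : P.PosDef)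
    (x : EuclideanSpace ℝ (Fin n)) : 0 ≤ quadFun P x := by
  have qform_nonneg : 0 ≤ qform P x := hP.posSemidef.dotProduct_mulVec_nonneg x.ofLp
  exact EReal.coe_nonneg.2 (by positivity)

theorem sup_quadFun_nonneg (hF : F.Nonempty)
    (hquad : ∀ f ∈ F, ∃ P : Matrix (Fin n) (Fin n) ℝ, P.PosDef ∧ f = quadFun P)
    (x : EuclideanSpace ℝ (Fin n)) : 0 ≤ F.sup id x := by
  obtain ⟨f, hf, hfx⟩ := exists_mem_sup_id_apply_eq hF x
  obtain ⟨P, hP, rfl⟩ := hquad f hf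
  exact hfx ▸ quadFun_nonneg hP x

/-- The pruning operation `prune` selects subsets and loses at most the factor `c` on suprema of
positive definite quadratic functions; `IsPruningOfOrder prune r` asks for the factor `1 + L τ^r`
for each `prune τ`. -/
def HasPruningFactor (prune : Finset (EuclideanSpace ℝ (Fin n) → EReal) →
    Finset (EuclideanSpace ℝ (Fin n) → EReal)) (c : ℝ) : Prop :=
  ∀ F : Finset (EuclideanSpace ℝ (Fin n) → EReal), F.Nonempty →
    (∀ f ∈ F, ∃ P : Matrix (Fin n) (Fin n) ℝ, P.PosDef ∧ f = quadFun P) →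
    prune F ⊆ F ∧ ∀ x, (prune F).sup id x ≤ F.sup id x ∧
      F.sup id x ≤ (c : EReal) * (prune F).sup id x

theorem HasPruningFactor.nonempty {prune : Finset (EuclideanSpace ℝ (Fin n) → EReal) →
    Finset (EuclideanSpace ℝ (Fin n) → EReal)} {c : ℝ} (h : HasPruningFactor prune c)
    (hc : 0 < c) (hF : F.Nonempty)
    (hquad : ∀ f ∈ F, ∃ P : Matrix (Fin n) (Fin n) ℝ, P.PosDef ∧ f = quadFun P) :
    (prune F).Nonempty := by
  by_contra empty
  have zero_le := (sup_quadFun_nonneg hF hquad 0).trans ((h F hF hquad).2 0).2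
  rw [Finset.not_nonempty_iff_eq_empty.1 empty, Finset.sup_empty, Pi.bot_apply,
    EReal.coe_mul_bot_of_pos hc] at zero_le
  exact absurd zero_le (by simp)

theorem hasPruningFactor_id {c : ℝ} (hc : 1 ≤ c) :
    HasPruningFactor (n := n) (fun F => F) c := by
  refine fun F hF hquad => ⟨Finset.Subset.refl F, fun x => ⟨le_rfl, ?_⟩⟩
  calc F.sup id x = 1 * F.sup id x := (one_mul _).symm
    _ ≤ c * F.sup id x :=
        mul_le_mul_of_nonneg_right (by exact_mod_cast hc) (sup_quadFun_nonneg hF hquad x)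

theorem isPruningOfOrder_id (r : ℝ) : IsPruningOfOrder (n := n) (fun _ F => F) r :=
  ⟨1, one_pos, fun _ hτ => hasPruningFactor_id (by
    rw [one_mul]
    exact le_add_of_nonneg_right (Real.rpow_nonneg hτ.le r))⟩

end Pruning

namespace SwitchedLQ

variable {n k M : ℕ} {p : SwitchedLQ n k M} {τ c ρ a : ℝ} {x : EuclideanSpace ℝ (Fin n)}
  {F : Finset (EuclideanSpace ℝ (Fin n) → EReal)} {𝒬 : Set (Matrix (Fin n) (Fin n) ℝ)}
  {prune : Finset (EuclideanSpace ℝ (Fin n) → EReal) →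
    Finset (EuclideanSpace ℝ (Fin n) → EReal)}

section ErrorPropagation

variable (p) in
theorem tildeS_mono (τ : ℝ) : Monotone (p.tildeS τ) := by
  intro V W hVW x
  refine iSup_mono fun m => ?_
  rw [← sup_eq_right.2 hVW, Sm_sup]
  exact le_sup_left

theorem S_le_of_forall_exists_le {T : ℝ} {V : EuclideanSpace ℝ (Fin n) → EReal} {b : EReal}
    {𝒱 : Set (EuclideanSpace ℝ (Fin n) → EReal)} (hV : ∀ y, ∃ W ∈ 𝒱, V y ≤ W y)
    (hb : ∀ W ∈ 𝒱, p.S T W x ≤ b) : p.S T V x ≤ b := by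
  refine sSup_le ?_
  rintro v ⟨w, μ, ξ, hw, hμ, hξ, rfl⟩
  obtain ⟨W, hW, hVW⟩ := hV (ξ T)
  calc p.payoff T V w μ ξ ≤ p.payoff T W w μ ξ := add_le_add_right hVW _
    _ ≤ p.S T W x := le_sSup ⟨w, μ, ξ, hw, hμ, hξ, rfl⟩
    _ ≤ b := hb W hW

theorem S_mul_sup_le (hρ : 0 ≤ ρ) (hF : F.Nonempty) (hquad : ∀ f ∈ F, f ∈ quadFun '' 𝒬)
    (hstep : ∀ P ∈ 𝒬, p.S τ (quadFun (a • P)) x ≤ (ρ : EReal) * p.tildeS τ (quadFun P) x) :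
    p.S τ (fun y => (a : EReal) * F.sup id y) x ≤ (ρ : EReal) * p.tildeS τ (F.sup id) x := by
  refine S_le_of_forall_exists_le (𝒱 := {W | ∃ P ∈ 𝒬, quadFun P ∈ F ∧ W = quadFun (a • P)})
    (fun y => ?_) ?_
  · obtain ⟨f, hf, hfy⟩ := exists_mem_sup_id_apply_eq hF y
    obtain ⟨P, hP, rfl⟩ := hquad f hf
    exact ⟨_, ⟨P, hP, hf, rfl⟩, by rw [hfy, coe_mul_quadFun]⟩
  · rintro _ ⟨P, hP, hPF, rfl⟩
    refine (hstep P hP).trans ?_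
    gcongr
    exact p.tildeS_mono τ (Finset.le_sup (f := id) hPF) x

theorem stepSet_nonempty [Nonempty (Fin M)] (hF : F.Nonempty) : (p.stepSet τ F).Nonempty := by
  classical
  exact (Finset.univ_nonempty.product hF).image _

theorem forall_mem_stepSet (hSm : ∀ m, ∀ P ∈ 𝒬, p.Sm m τ (quadFun P) ∈ quadFun '' 𝒬)
    (hquad : ∀ f ∈ F, f ∈ quadFun '' 𝒬) : ∀ f ∈ p.stepSet τ F, f ∈ quadFun '' 𝒬 := by
  classical
  intro f hf
  obtain ⟨⟨m, g⟩, hmg, rfl⟩ := Finset.mem_image.1 hf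
  obtain ⟨P, hP, rfl⟩ := hquad g (Finset.mem_product.1 hmg).2
  exact hSm m P hP

theorem exists_posDef_of_mem_image (h𝒬 : ∀ P ∈ 𝒬, P.PosDef) (hquad : ∀ f ∈ F, f ∈ quadFun '' 𝒬) :
    ∀ f ∈ F, ∃ P : Matrix (Fin n) (Fin n) ℝ, P.PosDef ∧ f = quadFun P := fun f hf => by
  obtain ⟨P, hP, rfl⟩ := hquad f hf
  exact ⟨P, h𝒬 P hP, rfl⟩

theorem prunedSet_nonempty_and_forall_mem [Nonempty (Fin M)] (h𝒬 : ∀ P ∈ 𝒬, P.PosDef)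
    (hSm : ∀ m, ∀ P ∈ 𝒬, p.Sm m τ (quadFun P) ∈ quadFun '' 𝒬) (hc : 0 < c)
    (hprune : HasPruningFactor prune c) {P₀ : Matrix (Fin n) (Fin n) ℝ} (hP₀ : P₀ ∈ 𝒬) (N : ℕ) :
    (p.prunedSet τ prune (quadFun P₀) N).Nonempty ∧
      ∀ f ∈ p.prunedSet τ prune (quadFun P₀) N, f ∈ quadFun '' 𝒬 := by
  induction N with
  | zero =>
    refine ⟨Finset.singleton_nonempty _, fun f hf => ?_⟩
    rw [Finset.mem_singleton.1 hf]
    exact mem_image_of_mem _ hP₀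
  | succ N ih =>
    have step_nonempty := stepSet_nonempty (p := p) (τ := τ) ih.1
    have step_quad := forall_mem_stepSet hSm ih.2
    have step_posDef := exists_posDef_of_mem_image h𝒬 step_quad
    exact ⟨hprune.nonempty hc step_nonempty step_posDef,
      fun f hf => step_quad f ((hprune _ step_nonempty step_posDef).1 hf)⟩

theorem S_le_mul_prunedIterate [Nonempty (Fin M)] (h𝒬 : ∀ P ∈ 𝒬, P.PosDef)
    (hSm : ∀ m, ∀ P ∈ 𝒬, p.Sm m τ (quadFun P) ∈ quadFun '' 𝒬) (hc : 0 < c)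
    (hprune : HasPruningFactor prune c) (hτ : 0 ≤ τ) (ha : 1 ≤ a) (hρ : 0 ≤ ρ)
    (hρc : ρ * c ≤ a)
    (hstep : ∀ P ∈ 𝒬, ∀ x,
      p.S τ (quadFun (a • P)) x ≤ (ρ : EReal) * p.tildeS τ (quadFun P) x)
    {P₀ : Matrix (Fin n) (Fin n) ℝ} (hP₀ : P₀ ∈ 𝒬) (N : ℕ) :
    p.S (N * τ) (quadFun P₀) ≤
      fun x => (a : EReal) * p.prunedIterate τ prune N (quadFun P₀) x := by
  induction N with
  | zero =>
    intro x
    simp only [prunedIterate, prunedSet, Finset.sup_singleton, id, Nat.cast_zero, zero_mul]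
    calc p.S 0 (quadFun P₀) x ≤ 1 * quadFun P₀ x := by
          rw [one_mul]
          exact p.S_zero_le _ x
      _ ≤ a * quadFun P₀ x :=
          mul_le_mul_of_nonneg_right (by exact_mod_cast ha) (quadFun_nonneg (h𝒬 P₀ hP₀) x)
  | succ N ih =>
    intro x
    set F := p.prunedSet τ prune (quadFun P₀) N
    obtain ⟨F_nonempty, F_quad⟩ :=
      prunedSet_nonempty_and_forall_mem (τ := τ) h𝒬 hSm hc hprune hP₀ N
    obtain ⟨next_nonempty, next_quad⟩ :=
      prunedSet_nonempty_and_forall_mem (τ := τ) h𝒬 hSm hc hprune hP₀ (N + 1)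
    have prune_le := ((hprune (p.stepSet τ F) (stepSet_nonempty F_nonempty)
      (exists_posDef_of_mem_image h𝒬 (forall_mem_stepSet hSm F_quad))).2 x).2
    have next_nonneg :=
      sup_quadFun_nonneg next_nonempty (exists_posDef_of_mem_image h𝒬 next_quad) x
    calc p.S ((N + 1 : ℕ) * τ) (quadFun P₀) x = p.S (τ + N * τ) (quadFun P₀) x := by
          rw [Nat.cast_succ, add_one_mul, add_comm]
      _ ≤ p.S τ (p.S (N * τ) (quadFun P₀)) x := p.S_add_le hτ (by positivity) _ x
      _ ≤ p.S τ (fun y => (a : EReal) * F.sup id y) x := p.S_mono τ ih x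
      _ ≤ ρ * p.tildeS τ (F.sup id) x :=
          S_mul_sup_le hρ F_nonempty F_quad fun P hP => hstep P hP x
      _ ≤ ρ * (c * (prune (p.stepSet τ F)).sup id x) := by
          rw [← sup_stepSet]
          gcongr
      _ = ((ρ * c : ℝ) : EReal) * (prune (p.stepSet τ F)).sup id x := by
          rw [← mul_assoc, EReal.coe_mul]
      _ ≤ a * (prune (p.stepSet τ F)).sup id x :=
          mul_le_mul_of_nonneg_right (by exact_mod_cast hρc) next_nonneg

variable (p) in
theorem prunedIterate_id (τ : ℝ) (N : ℕ) (V : EuclideanSpace ℝ (Fin n) → EReal) :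
    p.prunedIterate τ (fun F => F) N V = (p.tildeS τ)^[N] V := by
  induction N with
  | zero => simp [prunedIterate, prunedSet]
  | succ N ih =>
    rw [Function.iterate_succ_apply', ← ih]
    exact p.sup_stepSet τ _

end ErrorPropagation

end SwitchedLQ

section StableError

theorem eventually_mul_rpow_le_nhdsGT (K : ℝ) {s b : ℝ} (hs : 0 < s) (hb : 0 < b) :
    ∀ᶠ τ in 𝓝[>] (0 : ℝ), K * τ ^ s ≤ b := by
  have rpow_tendsto : Tendsto (fun τ : ℝ => τ ^ s) (𝓝[>] 0) (𝓝[>] 0) := by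
    refine tendsto_nhdsWithin_iff.2 ⟨?_, ?_⟩
    · have := (Real.continuousAt_rpow_const 0 s (.inr hs.le)).tendsto
      rw [Real.zero_rpow hs.ne'] at this
      exact this.mono_left nhdsWithin_le_nhds
    · filter_upwards [self_mem_nhdsWithin] with τ hτ using Real.rpow_pos_of_pos hτ s
  exact rpow_tendsto.eventually (eventually_mul_le_nhdsGT K hb)

theorem one_step_factor_mul_le {α C L τ Θ u v : ℝ} (hC : 0 ≤ C) (hL : 0 ≤ L)
    (hΘ : Θ ∈ Icc 0 1) (hατ : α * τ ∈ Icc 0 1) (hτ : τ ^ 2 ≤ 1) (hτu : τ ^ 2 ≤ u)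
    (hv : 0 ≤ v) (hvu : v ≤ u) (hbalance : Θ * (α * τ) = (C + L * (2 + C)) * u) :
    (1 + Θ * (1 - α * τ) + C * τ ^ 2) * (1 + L * v) ≤ 1 + Θ := by
  have contraction_le : Θ * (1 - α * τ) ≤ 1 * 1 := by
    gcongr
    exacts [sub_nonneg.2 hατ.2, hΘ.2, by linarith [hατ.1]]
  have factor_le : 1 + Θ * (1 - α * τ) + C * τ ^ 2 ≤ 2 + C := by
    linarith [mul_le_of_le_one_right hC hτ]
  calc (1 + Θ * (1 - α * τ) + C * τ ^ 2) * (1 + L * v)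
      = 1 + Θ - Θ * (α * τ) + C * τ ^ 2 + (1 + Θ * (1 - α * τ) + C * τ ^ 2) * (L * v) := by ring
    _ ≤ 1 + Θ - Θ * (α * τ) + C * u + (2 + C) * (L * u) := by gcongr
    _ = 1 + Θ := by
        rw [hbalance]
        ring

theorem exists_stable_relative_error {α C L r θ₁ : ℝ} (hα : 0 < α) (hC : 0 ≤ C) (hL : 0 < L)
    (hr : 1 < r) (hθ₁ : 0 < θ₁) :
    ∃ K > 0, ∀ᶠ τ in 𝓝[>] (0 : ℝ), K * τ ^ min 1 (r - 1) ∈ Icc 0 θ₁ ∧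
      0 ≤ 1 + K * τ ^ min 1 (r - 1) * (1 - α * τ) + C * τ ^ 2 ∧
      (1 + K * τ ^ min 1 (r - 1) * (1 - α * τ) + C * τ ^ 2) * (1 + L * τ ^ r) ≤
        1 + K * τ ^ min 1 (r - 1) := by
  set s := min 1 (r - 1)
  have s_pos : 0 < s := lt_min one_pos (by linarith)
  -- The gain `α τ · K τ ^ s` has to pay for the step error `C τ ^ 2` and the pruning loss.
  set K := (C + L * (2 + C)) / α with hK
  refine ⟨K, by positivity, ?_⟩
  filter_upwards [self_mem_nhdsWithin, eventually_mul_le_nhdsGT 1 one_pos,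
    eventually_mul_le_nhdsGT α one_pos, eventually_mul_rpow_le_nhdsGT K s_pos hθ₁,
    eventually_mul_rpow_le_nhdsGT K s_pos one_pos] with τ hτ τ_le ατ_le Θ_le Θ_le_one
  rw [mem_Ioi] at hτ
  rw [one_mul] at τ_le
  have Θ_nonneg : 0 ≤ K * τ ^ s := by positivity
  have sq_le : τ ^ 2 ≤ τ ^ (1 + s) := by
    rw [← Real.rpow_natCast]
    exact Real.rpow_le_rpow_of_exponent_ge hτ τ_le
      (by linarith [min_le_left 1 (r - 1), Nat.cast_ofNat (R := ℝ) (n := 2)])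
  have rpow_le : τ ^ r ≤ τ ^ (1 + s) :=
    Real.rpow_le_rpow_of_exponent_ge hτ τ_le (by linarith [min_le_right 1 (r - 1)])
  have balance : K * τ ^ s * (α * τ) = (C + L * (2 + C)) * τ ^ (1 + s) := by
    rw [hK, Real.rpow_add hτ, Real.rpow_one]
    field_simp
  exact ⟨⟨Θ_nonneg, Θ_le⟩, SwitchedLQ.one_step_factor_nonneg Θ_nonneg ατ_le hC,
    one_step_factor_mul_le hC hL.le ⟨Θ_nonneg, Θ_le_one⟩ ⟨by positivity, ατ_le⟩
      (pow_le_one₀ hτ.le τ_le) sq_le (Real.rpow_nonneg hτ.le r) rpow_le balance⟩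

end StableError

namespace SwitchedLQ

variable {n k M : ℕ} {p : SwitchedLQ n k M} {ε lam Λ η θ₁ r : ℝ}
  {prune : ℝ → Finset (EuclideanSpace ℝ (Fin n) → EReal) →
    Finset (EuclideanSpace ℝ (Fin n) → EReal)}

section ErrorBound

theorem IsInvariantInterval.Sm_quadFun_mem_image (h : p.IsInvariantInterval ε lam)
    (hγ : p.γ ≠ 0) (hε : 0 ≤ ε) {τ : ℝ} (hτ : 0 ≤ τ) (m : Fin M)
    {P : Matrix (Fin n) (Fin n) ℝ} (hP : P ∈ loewnerIcc n ε lam) :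
    p.Sm m τ (quadFun P) ∈ quadFun '' loewnerIcc n ε lam := by
  obtain ⟨_, _, step⟩ := h.exists_Sm_quadFun_eq hγ hε
  obtain ⟨Q, hQ, hSm, -⟩ := step m τ P hτ hP
  exact ⟨Q, hQ, hSm.symm⟩

theorem IsInvariantInterval.bot_lt_S_quadFun [Nonempty (Fin M)]
    (h : p.IsInvariantInterval ε lam) (hγ : p.γ ≠ 0) (hε : 0 ≤ ε) {T : ℝ} (hT : 0 ≤ T)
    {P : Matrix (Fin n) (Fin n) ℝ} (hP : P ∈ loewnerIcc n ε lam) (x : EuclideanSpace ℝ (Fin n)) :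
    ⊥ < p.S T (quadFun P) x := by
  obtain ⟨m⟩ := ‹Nonempty (Fin M)›
  obtain ⟨Q, -, hSm⟩ := h.Sm_quadFun_mem_image hγ hε hT m hP
  calc ⊥ < quadFun Q x := EReal.bot_lt_coe _
    _ = p.Sm m T (quadFun P) x := congrFun hSm x
    _ ≤ p.S T (quadFun P) x := p.Sm_le_S m T _ x

theorem IsInvariantInterval.exists_S_le_mul_prunedIterate [Nonempty (Fin M)]
    (h : p.IsInvariantInterval ε lam) (hγ : p.γ ≠ 0) (hε : 0 < ε) (hΛ : 0 < Λ) (hlam : lam ≤ Λ)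
    (hη : 0 < η) (hθ₁ : θ₁ ∈ Ioc 0 1) (hsub : p.IsStrictlySubhomogeneous Λ η θ₁) (hr : 1 < r)
    (hprune : IsPruningOfOrder prune r) :
    ∃ K > 0, ∀ᶠ τ in 𝓝[>] (0 : ℝ), ∀ N : ℕ, ∀ P₀ ∈ loewnerIcc n ε lam, ∀ x,
      (∃ Q ∈ loewnerIcc n ε lam,
        p.prunedIterate τ (prune τ) N (quadFun P₀) x = quadFun Q x) ∧
      p.S (N * τ) (quadFun P₀) x ≤ ((1 + K * τ ^ min 1 (r - 1) : ℝ) : EReal) *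
        p.prunedIterate τ (prune τ) N (quadFun P₀) x := by
  obtain ⟨L, hL, prune_factor⟩ := hprune
  obtain ⟨α, hα, C, hC, one_step⟩ := h.exists_S_smul_le_mul_tildeS hγ hε hΛ hlam hη hθ₁.2 hsub
  obtain ⟨K, hK, stable⟩ := exists_stable_relative_error hα hC.le hL hr hθ₁.1
  refine ⟨K, hK, ?_⟩
  filter_upwards [self_mem_nhdsWithin, one_step, stable]
    with τ hτ one_step ⟨Θ_mem, ρ_nonneg, ρ_le⟩ N P₀ hP₀ x
  rw [mem_Ioi] at hτ
  have posDef : ∀ P ∈ loewnerIcc n ε lam, P.PosDef := fun _ => posDef_of_mem_loewnerIcc hε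
  have Sm_mem : ∀ m, ∀ P ∈ loewnerIcc n ε lam,
      p.Sm m τ (quadFun P) ∈ quadFun '' loewnerIcc n ε lam :=
    fun m _ => h.Sm_quadFun_mem_image hγ hε.le hτ.le m
  have factor_pos : 0 < 1 + L * τ ^ r := by positivity
  have factor : HasPruningFactor (prune τ) (1 + L * τ ^ r) := prune_factor τ hτ
  refine ⟨?_, S_le_mul_prunedIterate posDef Sm_mem factor_pos factor hτ.le
    (le_add_of_nonneg_right Θ_mem.1) ρ_nonneg ρ_le (one_step _ Θ_mem) hP₀ N x⟩
  obtain ⟨nonempty, quad⟩ :=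
    prunedSet_nonempty_and_forall_mem posDef Sm_mem factor_pos factor hP₀ N
  obtain ⟨f, hf, hfx⟩ := exists_mem_sup_id_apply_eq nonempty x
  obtain ⟨Q, hQ, rfl⟩ := quad f hf
  exact ⟨Q, hQ, hfx⟩

theorem exists_coe_eq_and_sub_le {v : EReal} {Θ : ℝ} {Q : Matrix (Fin n) (Fin n) ℝ}
    {x : EuclideanSpace ℝ (Fin n)} (hv : ⊥ < v)
    (hle : v ≤ ((1 + Θ : ℝ) : EReal) * quadFun Q x) (hΘ : 0 ≤ Θ)
    (hQ : qform Q x ≤ Λ * ‖x‖ ^ 2) :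
    ∃ a : ℝ, v = a ∧ a - 1 / 2 * qform Q x ≤ Θ * (Λ / 2) * ‖x‖ ^ 2 := by
  rw [coe_mul_quadFun, quadFun, qform_smul] at hle
  lift v to ℝ using ⟨ne_top_of_le_ne_top (EReal.coe_ne_top _) hle, hv.ne'⟩
  refine ⟨v, rfl, ?_⟩
  calc v - 1 / 2 * qform Q x
      ≤ 1 / 2 * ((1 + Θ) * qform Q x) - 1 / 2 * qform Q x := by
        gcongr
        exact EReal.coe_le_coe_iff.1 hle
    _ = Θ / 2 * qform Q x := by ring
    _ ≤ Θ / 2 * (Λ * ‖x‖ ^ 2) := by gcongr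
    _ = Θ * (Λ / 2) * ‖x‖ ^ 2 := by ring

theorem IsInvariantInterval.exists_S_sub_prunedIterate_le [Nonempty (Fin M)]
    (h : p.IsInvariantInterval ε lam) (hγ : p.γ ≠ 0) {cσ mD : ℝ} (hcσ : 0 < cσ)
    (hσ : ∀ m, ‖p.σ m‖ ≤ cσ) (hmD : 0 < mD) (hD : ∀ m x, mD * ‖x‖ ^ 2 ≤ qform (p.D m) x)
    (hlam : lam < p.lam2 cσ mD) (hε : 0 < ε) (hr : 1 < r) (hprune : IsPruningOfOrder prune r) :
    ∃ τ₀ : ℝ, 0 < τ₀ ∧ ∃ L : ℝ, 0 < L ∧ ∀ (N : ℕ) (τ : ℝ), 0 < τ → τ ≤ τ₀ →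
      ∀ P₀ ∈ loewnerIcc n ε lam, ∀ x, ∃ a b : ℝ,
        p.S (N * τ) (quadFun P₀) x = (a : EReal) ∧
        p.prunedIterate τ (prune τ) N (quadFun P₀) x = (b : EReal) ∧
        a - b ≤ L * τ ^ min 1 (r - 1) * ‖x‖ ^ 2 := by
  have lam2_pos : 0 < p.lam2 cσ mD := Real.sqrt_pos.2 (by positivity)
  obtain ⟨Λ, hΛ, hΛ_lt⟩ := exists_between (max_lt hlam lam2_pos)
  obtain ⟨lam_lt, Λ_pos⟩ := max_lt_iff.1 hΛ
  obtain ⟨η, hη, θ₁, hθ₁, hsub⟩ := exists_isStrictlySubhomogeneous hγ hcσ hσ hD Λ_pos hΛ_lt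
  obtain ⟨K, hK, relative⟩ :=
    h.exists_S_le_mul_prunedIterate hγ hε Λ_pos lam_lt.le hη hθ₁ hsub hr hprune
  obtain ⟨τ₀, hτ₀, hτ₀_sub⟩ := mem_nhdsGT_iff_exists_Ioc_subset.1 relative
  refine ⟨τ₀, hτ₀, K * (Λ / 2), by positivity, fun N τ hτ hττ₀ P₀ hP₀ x => ?_⟩
  obtain ⟨⟨Q, hQ, iterate_eq⟩, S_le⟩ := hτ₀_sub ⟨hτ, hττ₀⟩ N P₀ hP₀ x
  rw [iterate_eq] at S_le ⊢
  obtain ⟨a, ha, hab⟩ := exists_coe_eq_and_sub_le (Λ := Λ)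
    (h.bot_lt_S_quadFun hγ hε.le (by positivity) hP₀ x) S_le (by positivity)
    (((mem_loewnerIcc_iff.1 hQ).2 x).2.trans (by gcongr))
  exact ⟨a, _, ha, rfl, hab.trans_eq (by ring)⟩

end ErrorBound

end SwitchedLQ

theorem mainTheorem2_general {n k M : ℕ} (hM : 0 < M) (p : SwitchedLQ n k M) (hγ : p.γ ≠ 0)
    {cσ mD : ℝ} (hcσ : 0 < cσ) (hσ : ∀ m, ‖p.σ m‖ ≤ cσ) (hmD : 0 < mD)
    (hD : ∀ m x, mD * ‖x‖ ^ 2 ≤ qform (p.D m) x) {lam : ℝ} (hlam : lam < p.lam2 cσ mD)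
    {ε : ℝ} (hε : 0 < ε) (hinv : p.IsInvariantInterval ε lam) :
    (∀ r : ℝ, 1 < r →
      ∀ prune : ℝ → Finset (EuclideanSpace ℝ (Fin n) → EReal) →
          Finset (EuclideanSpace ℝ (Fin n) → EReal),
        IsPruningOfOrder prune r →
        ∃ τ₀ : ℝ, 0 < τ₀ ∧ ∃ L : ℝ, 0 < L ∧
          ∀ (N : ℕ) (τ : ℝ), 0 < τ → τ ≤ τ₀ →
          ∀ P₀ ∈ loewnerIcc n ε lam, ∀ x : EuclideanSpace ℝ (Fin n),
            ∃ a b : ℝ, p.S (N * τ) (quadFun P₀) x = (a : EReal) ∧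
              p.prunedIterate τ (prune τ) N (quadFun P₀) x = (b : EReal) ∧
              a - b ≤ L * τ ^ min 1 (r - 1) * ‖x‖ ^ 2) ∧
    (∃ τ₀ : ℝ, 0 < τ₀ ∧ ∃ L : ℝ, 0 < L ∧
      ∀ (N : ℕ) (τ : ℝ), 0 < τ → τ ≤ τ₀ →
      ∀ P₀ ∈ loewnerIcc n ε lam, ∀ x : EuclideanSpace ℝ (Fin n),
        ∃ a b : ℝ, p.S (N * τ) (quadFun P₀) x = (a : EReal) ∧
          (p.tildeS τ)^[N] (quadFun P₀) x = (b : EReal) ∧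
          a - b ≤ L * τ * ‖x‖ ^ 2) := by
  have : Nonempty (Fin M) := ⟨⟨0, hM⟩⟩
  refine ⟨fun r hr prune => hinv.exists_S_sub_prunedIterate_le hγ hcσ hσ hmD hD hlam hε hr, ?_⟩
  have unpruned := hinv.exists_S_sub_prunedIterate_le hγ hcσ hσ hmD hD hlam hε one_lt_two
    (isPruningOfOrder_id 2)
  have order : min (1 : ℝ) (2 - 1) = 1 := by norm_num
  simpa only [order, Real.rpow_one, p.prunedIterate_id] using unpruned

theorem mainTheorem2 {n k M : ℕ} (hM : 0 < M) (p : SwitchedLQ n k M) (cA cσ cD mD : ℝ)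
    (h1 : p.Assumption1 cA cσ cD) (h2 : p.Assumption2 cA cσ cD mD)
    (lam : ℝ) (hlam : lam ∈ Set.Ico (p.lam1 cA cσ cD) (p.lam2 cσ mD))
    (ε : ℝ) (hε : 0 < ε) (hinv : p.IsInvariantInterval ε lam) :
    (∀ r : ℝ, 1 < r →
      ∀ prune : ℝ → Finset (EuclideanSpace ℝ (Fin n) → EReal) →
          Finset (EuclideanSpace ℝ (Fin n) → EReal),
        IsPruningOfOrder prune r →
        ∃ τ₀ : ℝ, 0 < τ₀ ∧ ∃ L : ℝ, 0 < L ∧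
          ∀ (N : ℕ) (τ : ℝ), 0 < τ → τ ≤ τ₀ →
          ∀ P₀ ∈ Set.Icc (ε • (1 : Matrix (Fin n) (Fin n) ℝ))
            (lam • (1 : Matrix (Fin n) (Fin n) ℝ)),
          ∀ x : EuclideanSpace ℝ (Fin n),
            ∃ a b : ℝ, p.S (N * τ) (quadFun P₀) x = (a : EReal) ∧
              p.prunedIterate τ (prune τ) N (quadFun P₀) x = (b : EReal) ∧
              a - b ≤ L * τ ^ min 1 (r - 1) * ‖x‖ ^ 2) ∧
    (∃ τ₀ : ℝ, 0 < τ₀ ∧ ∃ L : ℝ, 0 < L ∧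
      ∀ (N : ℕ) (τ : ℝ), 0 < τ → τ ≤ τ₀ →
      ∀ P₀ ∈ Set.Icc (ε • (1 : Matrix (Fin n) (Fin n) ℝ))
        (lam • (1 : Matrix (Fin n) (Fin n) ℝ)),
      ∀ x : EuclideanSpace ℝ (Fin n),
        ∃ a b : ℝ, p.S (N * τ) (quadFun P₀) x = (a : EReal) ∧
          (p.tildeS τ)^[N] (quadFun P₀) x = (b : EReal) ∧
          a - b ≤ L * τ * ‖x‖ ^ 2) :=
  mainTheorem2_general hM p h1.γ_pos.ne' h1.cσ_pos h1.σ_le h2.mD_pos h2.D_ge hlam.2 hε hinv
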